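/- **Definitions.** A category $I$ is *finitely generated* if there are finitely many arrows whose closure under composition consists of all arrows of $I$ (including the identities, so $I$ has finitely many objects). A *diagram* of shape $I$ in a category $C$ is a functor $F : I \to C$; a *cocone* over it is an object $X$ with morphisms $f_i : F(i) \to X$ such that $f_i = f_j \circ F(a)$ for every $a : i \to j$. $C$ has the *AP* if every diagram of shape $\bullet \leftarrow \bullet \to \bullet$ in $C$ has a cocone, and the *JEP* if every diagram of finite discrete shape (including the empty shape) in $C$ has a cocone. $\mathbf{Inj}$ is the category of sets and injections. A category is *connected* if it is nonempty and any two objects are joined by a zigzag of morphisms; it is *simply-connected* if its fundamental groupoid (the groupoid freely generated by the category) has at most one morphism between any two objects (connectedness is not required). An *inverse category* is a category in which every morphism $f : X \to Y$ has a unique pseudoinverse $f^{-1} : Y \to X$, i.e. one with $f f^{-1} f = f$ and $f^{-1} f f^{-1} = f^{-1}$. Let $L(I)$ be the inverse category freely generated by $I$ such that every arrow of $I$ becomes monic: there is a functor $\eta : I \to L(I)$ with $\eta(a)^{-1} \circ \eta(a) = 1$ for all arrows $a$, and every functor $F$ from $I$ to an inverse category with $F(a)^{-1} \circ F(a) = 1$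 for all $a$ factors uniquely through $\eta$. $I$ is *upward-simply-connected* if every endomorphism $f$ in $L(I)$ is idempotent, $f \circ f = f$. Finite *tree-like* posets are defined inductively: if $n \ge 0$, $K_1, \dots, K_n$ are finite tree-like posets and $U_k \subseteq K_k$ is a connected (hence nonempty) upward-closed subset for each $k$, then the disjoint union of the $K_k$ together with one new point lying below exactly the elements of $U_1 \cup \dots \cup U_n$ (and itself) is tree-like; the class is closed under isomorphism. A finite poset is *forest-like* if it is a finite disjoint union of tree-like posets. A poset is regarded as a category with a unique arrow $x \to y$ iff $x \le y$. **Theorem.** Let $I$ be a finitely generated category. The following are equivalent: (i) every $I$-shaped diagram in a category with the AP and the JEP has a cocone; (ii) every $I$-shaped diagram in $\mathbf{Inj}$ has a cocone; (iii) $I$ is upward-simply-connected. If $I$ is finite (finitely many objects and arrows), then (ii) is equivalent to its restriction to diagrams $F : I \to \mathbf{Inj}$ all of whose values $F(i)$ are finite sets. If $I$ is a finite poset, then (i), (ii), (iii) are further equivalent to: (iv) every upward-closed subset of $I$, with the induced order, is simply-connected; (v) $I$ is forest-like. Similarly, for a finitely generated category $I$, every $I$-shaped diagram in a category with the AP has a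 cocone if and only if $I$ is connected and (ii) holds, if and only if $I$ is connected and (iii) holds; and if $I$ is a finite poset, this is also equivalent to $I$ being connected and satisfying (iv), and to $I$ being connected and satisfying (v). -/

import Mathlib

open CategoryTheory CategoryTheory.Limits

universe u v u₁ v₁ w

namespace AmalgamableShapes

/-! ### Finite generation, cocones, AP and JEP -/

/-- `I` is finitely generated: there are finitely many arrows whose closure under (binary)
composition consists of all arrows. Identities have to be obtained as well, so such an `I` has
finitely many objects. -/
def IsFinitelyGenerated (I : Type u) [Category.{v} I] : Prop :=
  ∃ W : MorphismProperty I, W.toSet.Finite ∧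
    ∀ W' : MorphismProperty I, W'.IsStableUnderComposition → W ≤ W' → W' = ⊤

/-- Every `J`-shaped diagram in `C` has a cocone. -/
def EveryDiagramHasCocone (J : Type u) [Category.{v} J] (C : Type u₁) [Category.{v₁} C] : Prop :=
  ∀ F : J ⥤ C, Nonempty (Cocone F)

/-- The amalgamation property: every diagram of shape `• ← • → •` has a cocone. -/
def AmalgamationProperty (C : Type u₁) [Category.{v₁} C] : Prop :=
  EveryDiagramHasCocone WalkingSpan C

/-- The joint embedding property: every diagram of finite discrete shape (including the empty
shape) has a cocone. -/
def JointEmbeddingProperty (C : Type u₁) [Category.{v₁} C] : Prop :=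
  ∀ n : ℕ, EveryDiagramHasCocone (Discrete (Fin n)) C

/-! ### Sets and injections -/

/-- The objects of the category of sets and injections. -/
structure Inj : Type (w + 1) where
  /-- The underlying set. -/
  carrier : Type w

instance : Category.{w} Inj.{w} where
  Hom X Y := X.carrier ↪ Y.carrier
  id X := Function.Embedding.refl X.carrier
  comp f g := f.trans g

/-! ### Simply-connected categories -/

/-- `I` is simply-connected: its fundamental groupoid (the free groupoid on the category `I`) has
at most one morphism between any two objects. Connectedness is not required. -/
def IsSimplyConnectedCategory (I : Type u) [Category.{v} I] : Prop :=
  Quiver.IsThin (FreeGroupoid I)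

/-! ### Inverse categories -/

section Inverse

variable {C : Type u₁} [Category.{v₁} C]

/-- `g` is a pseudoinverse of `f`. -/
def IsPseudoinverse {X Y : C} (f : X ⟶ Y) (g : Y ⟶ X) : Prop :=
  f ≫ g ≫ f = f ∧ g ≫ f ≫ g = g

variable (C) in
/-- An inverse category: every morphism has a unique pseudoinverse. -/
def IsInverseCategory : Prop :=
  ∀ (X Y : C) (f : X ⟶ Y), ∃! g : Y ⟶ X, IsPseudoinverse f g

variable (C) in
/-- An idempotent category: every endomorphism is idempotent. -/
def IsIdempotentCategory : Prop :=
  ∀ (X : C) (f : X ⟶ X), f ≫ f = f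

theorem IsPseudoinverse.symm {X Y : C} {f : X ⟶ Y} {g : Y ⟶ X} (h : IsPseudoinverse f g) :
    IsPseudoinverse g f := ⟨h.2, h.1⟩

theorem IsInverseCategory.comp_idem (hC : IsInverseCategory C) {X : C} {e f : X ⟶ X}
    (he : e ≫ e = e) (hf : f ≫ f = f) : (e ≫ f) ≫ (e ≫ f) = e ≫ f := by
  obtain ⟨x, hx, -⟩ := hC X X (e ≫ f)
  have h1 : e ≫ f ≫ x ≫ e ≫ f = e ≫ f := by simpa using hx.1
  have h2 : x ≫ e ≫ f ≫ x = x := by simpa using hx.2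
  have he' : ∀ {Z : C} (k : X ⟶ Z), e ≫ e ≫ k = e ≫ k := fun k => by
    rw [← Category.assoc, he]
  have hf' : ∀ {Z : C} (k : X ⟶ Z), f ≫ f ≫ k = f ≫ k := fun k => by
    rw [← Category.assoc, hf]
  have h2' : ∀ {Z : C} (k : X ⟶ Z), x ≫ e ≫ f ≫ x ≫ k = x ≫ k := fun k => by
    conv_rhs => rw [← h2]
    simp
  have hy : IsPseudoinverse (e ≫ f) (f ≫ x ≫ e) := by
    constructor
    · simp only [Category.assoc, he', hf', h1]
    · simp only [Category.assoc, he', hf', h2']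
  have hyy : (f ≫ x ≫ e) ≫ (f ≫ x ≫ e) = f ≫ x ≫ e := by
    simp only [Category.assoc, h2']
  have hself : IsPseudoinverse (f ≫ x ≫ e) (f ≫ x ≫ e) := by
    constructor <;> rw [hyy, hyy]
  have key : e ≫ f = f ≫ x ≫ e := (hC X X _).unique hy.symm hself
  rw [key, hyy]

theorem IsInverseCategory.idem_comm (hC : IsInverseCategory C) {X : C} {e f : X ⟶ X}
    (he : e ≫ e = e) (hf : f ≫ f = f) : e ≫ f = f ≫ e := by
  have h1 := hC.comp_idem he hf
  have h2 := hC.comp_idem hf he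
  have he' : ∀ {Z : C} (k : X ⟶ Z), e ≫ e ≫ k = e ≫ k := fun k => by
    rw [← Category.assoc, he]
  have hf' : ∀ {Z : C} (k : X ⟶ Z), f ≫ f ≫ k = f ≫ k := fun k => by
    rw [← Category.assoc, hf]
  refine (hC X X (e ≫ f)).unique ⟨?_, ?_⟩ ⟨?_, ?_⟩
  · rw [h1, h1]
  · rw [h1, h1]
  · simpa only [Category.assoc, he', hf'] using h1
  · simpa only [Category.assoc, he', hf'] using h2

/-- A category in which morphisms have pseudoinverses and idempotents commute is inverse. -/
theorem isInverseCategory_of_idem_comm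
    (h1 : ∀ (X Y : C) (f : X ⟶ Y), ∃ g : Y ⟶ X, IsPseudoinverse f g)
    (h2 : ∀ (X : C) (e f : X ⟶ X), e ≫ e = e → f ≫ f = f → e ≫ f = f ≫ e) :
    IsInverseCategory C := by
  intro X Y f
  obtain ⟨g, hg⟩ := h1 X Y f
  refine ⟨g, hg, fun k hk => ?_⟩
  have idem : ∀ {A B : C} {a : A ⟶ B} {b : B ⟶ A}, IsPseudoinverse a b →
      (a ≫ b) ≫ (a ≫ b) = a ≫ b := fun {A B a b} h => by
    rw [Category.assoc, h.2]
  have e1 : g = g ≫ f ≫ k := by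
    calc g = g ≫ (f ≫ k ≫ f) ≫ g := by rw [hk.1, hg.2]
      _ = g ≫ (f ≫ k) ≫ (f ≫ g) := by simp
      _ = g ≫ (f ≫ g) ≫ (f ≫ k) := by rw [h2 _ _ _ (idem hk) (idem hg)]
      _ = (g ≫ f ≫ g) ≫ f ≫ k := by simp
      _ = g ≫ f ≫ k := by rw [hg.2]
  have e2 : k = g ≫ f ≫ k := by
    calc k = (k ≫ (f ≫ g ≫ f)) ≫ k := by rw [hg.1, Category.assoc, hk.2]
      _ = ((k ≫ f) ≫ (g ≫ f)) ≫ k := by simp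
      _ = ((g ≫ f) ≫ (k ≫ f)) ≫ k := by rw [h2 _ _ _ (idem hk.symm) (idem hg.symm)]
      _ = g ≫ f ≫ (k ≫ f ≫ k) := by simp
      _ = g ≫ f ≫ k := by rw [hk.2]
  rw [e1, ← e2]

/-- The pseudoinverse of a morphism in an inverse category. -/
noncomputable def IsInverseCategory.pinv (hC : IsInverseCategory C) {X Y : C} (f : X ⟶ Y) :
    Y ⟶ X := (hC X Y f).choose

theorem IsInverseCategory.pinv_spec (hC : IsInverseCategory C) {X Y : C} (f : X ⟶ Y) :
    IsPseudoinverse f (hC.pinv f) := (hC X Y f).choose_spec.1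

end Inverse

/-! ### The left fundamental inverse category `L(I)` -/

section LeftFundamental

variable (I : Type u) [Category.{v} I]

/-- Formal composites of arrows of `I` and formal pseudoinverses (in diagrammatic order). -/
inductive PreHom : I → I → Type (max u v)
  | of {X Y : I} (f : X ⟶ Y) : PreHom X Y
  | comp {X Y Z : I} (p : PreHom X Y) (q : PreHom Y Z) : PreHom X Z
  | inv {X Y : I} (p : PreHom X Y) : PreHom Y X

variable {I}

/-- The least congruence making the formal composites into an inverse category, in which the arrows
of `I` compose as in `I` and satisfy `i⁻¹ ∘ i = 1`, i.e. become monic. (An involution with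
`p p⁻¹ p = p` such that the idempotents `p p⁻¹` commute is the usual equational description of
pseudoinverses.) -/
inductive PreHomRel : ∀ {X Y : I}, PreHom I X Y → PreHom I X Y → Prop
  | refl {X Y : I} (p : PreHom I X Y) : PreHomRel p p
  | symm {X Y : I} {p q : PreHom I X Y} : PreHomRel p q → PreHomRel q p
  | trans {X Y : I} {p q r : PreHom I X Y} : PreHomRel p q → PreHomRel q r → PreHomRel p r
  | comp_congr {X Y Z : I} {p p' : PreHom I X Y} {q q' : PreHom I Y Z} :
      PreHomRel p p' → PreHomRel q q' → PreHomRel (p.comp q) (p'.comp q')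
  | inv_congr {X Y : I} {p p' : PreHom I X Y} : PreHomRel p p' → PreHomRel p.inv p'.inv
  | assoc {W X Y Z : I} (p : PreHom I W X) (q : PreHom I X Y) (r : PreHom I Y Z) :
      PreHomRel ((p.comp q).comp r) (p.comp (q.comp r))
  | id_comp {X Y : I} (p : PreHom I X Y) : PreHomRel ((PreHom.of (𝟙 X)).comp p) p
  | comp_id {X Y : I} (p : PreHom I X Y) : PreHomRel (p.comp (PreHom.of (𝟙 Y))) p
  | of_comp {X Y Z : I} (f : X ⟶ Y) (g : Y ⟶ Z) :
      PreHomRel (PreHom.of (f ≫ g)) ((PreHom.of f).comp (PreHom.of g))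
  | inv_inv {X Y : I} (p : PreHom I X Y) : PreHomRel p.inv.inv p
  | comp_inv_comp {X Y : I} (p : PreHom I X Y) : PreHomRel (p.comp (p.inv.comp p)) p
  | idem_comm {X Y Z : I} (p : PreHom I X Y) (q : PreHom I X Z) :
      PreHomRel ((p.comp p.inv).comp (q.comp q.inv)) ((q.comp q.inv).comp (p.comp p.inv))
  | monic {X Y : I} (f : X ⟶ Y) :
      PreHomRel ((PreHom.of f).comp (PreHom.of f).inv) (PreHom.of (𝟙 X))

instance preHomSetoid (X Y : I) : Setoid (PreHom I X Y) where
  r := PreHomRel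
  iseqv := ⟨PreHomRel.refl, PreHomRel.symm, PreHomRel.trans⟩

variable (I) in
/-- The left fundamental inverse category `L(I)`: the inverse category freely generated by `I` such
that every morphism of `I` becomes monic. It has the same objects as `I`. -/
structure LeftFundamental where
  /-- The corresponding object of `I`. -/
  as : I

instance : Category.{max u v} (LeftFundamental I) where
  Hom X Y := Quotient (preHomSetoid X.as Y.as)
  id X := Quotient.mk _ (PreHom.of (𝟙 X.as))
  comp f g := Quotient.map₂ PreHom.comp (fun _ _ h _ _ h' => PreHomRel.comp_congr h h') f g
  id_comp f := Quotient.inductionOn f fun p => Quotient.sound (PreHomRel.id_comp p)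
  comp_id f := Quotient.inductionOn f fun p => Quotient.sound (PreHomRel.comp_id p)
  assoc f g h := Quotient.inductionOn₃ f g h fun p q r => Quotient.sound (PreHomRel.assoc p q r)

namespace LeftFundamental

/-- The morphism of `L(I)` represented by a formal composite. -/
def homMk {X Y : I} (p : PreHom I X Y) : (⟨X⟩ : LeftFundamental I) ⟶ ⟨Y⟩ := Quotient.mk _ p

variable (I) in
/-- The canonical functor `η : I ⥤ L(I)`. -/
def eta : I ⥤ LeftFundamental I where
  obj X := ⟨X⟩
  map f := homMk (PreHom.of f)
  map_id _ := rfl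
  map_comp f g := Quotient.sound (PreHomRel.of_comp f g)

theorem homMk_surjective {X Y : LeftFundamental I} (f : X ⟶ Y) :
    ∃ p : PreHom I X.as Y.as, homMk p = f := Quotient.exists_rep f

theorem homMk_comp {X Y Z : I} (p : PreHom I X Y) (q : PreHom I Y Z) :
    homMk (p.comp q) = homMk p ≫ homMk q := rfl

theorem homMk_isPseudoinverse {X Y : I} (p : PreHom I X Y) :
    IsPseudoinverse (homMk p) (homMk p.inv) := by
  constructor
  · exact Quotient.sound (PreHomRel.comp_inv_comp p)
  · refine Quotient.sound (PreHomRel.trans ?_ (PreHomRel.comp_inv_comp p.inv))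
    exact PreHomRel.comp_congr (PreHomRel.refl _)
      (PreHomRel.comp_congr (PreHomRel.symm (PreHomRel.inv_inv p)) (PreHomRel.refl _))

theorem homMk_idem_comm {X Y Z : I} (p : PreHom I X Y) (q : PreHom I X Z) :
    (homMk p ≫ homMk p.inv) ≫ (homMk q ≫ homMk q.inv) =
      (homMk q ≫ homMk q.inv) ≫ (homMk p ≫ homMk p.inv) :=
  Quotient.sound (PreHomRel.idem_comm p q)

theorem homMk_inv_inv {X Y : I} (p : PreHom I X Y) : homMk p.inv.inv = homMk p :=
  Quotient.sound (PreHomRel.inv_inv p)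

theorem homMk_eq_of_idem {X : I} (p : PreHom I X X) (hp : homMk p ≫ homMk p = homMk p) :
    homMk p = homMk p ≫ homMk p.inv := by
  obtain ⟨h1, h2⟩ := homMk_isPseudoinverse p
  have hc := homMk_idem_comm p p.inv
  rw [homMk_inv_inv] at hc
  have hp' : ∀ {Z : LeftFundamental I} (k : ⟨X⟩ ⟶ Z),
      homMk p ≫ homMk p ≫ k = homMk p ≫ k := fun k => by rw [← Category.assoc, hp]
  have h3 : homMk p.inv = (homMk p ≫ homMk p.inv) ≫ (homMk p.inv ≫ homMk p) := by
    rw [hc]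
    simp only [Category.assoc, hp', h2]
  have h4 : homMk p = homMk p.inv := by
    calc homMk p = homMk p ≫ homMk p.inv ≫ homMk p := h1.symm
      _ = homMk p ≫ ((homMk p ≫ homMk p.inv) ≫ (homMk p.inv ≫ homMk p)) ≫ homMk p := by
          rw [← h3]
      _ = (homMk p ≫ homMk p.inv) ≫ (homMk p.inv ≫ homMk p) := by
          simp only [Category.assoc, hp', hp]
      _ = homMk p.inv := h3.symm
  rw [← h4, hp]

variable (I) in
/-- `L(I)` is an inverse category. -/
theorem isInverseCategory : IsInverseCategory (LeftFundamental I) := by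
  refine isInverseCategory_of_idem_comm (fun X Y f => ?_) (fun X a b ha hb => ?_)
  · obtain ⟨p, rfl⟩ := homMk_surjective f
    exact ⟨homMk p.inv, homMk_isPseudoinverse p⟩
  · obtain ⟨p, rfl⟩ := homMk_surjective a
    obtain ⟨q, rfl⟩ := homMk_surjective b
    rw [homMk_eq_of_idem p ha, homMk_eq_of_idem q hb, homMk_idem_comm]

variable (I) in
/-- In `L(I)`, every arrow `i` of `I` satisfies `i⁻¹ ∘ i = 1`. -/
theorem eta_monic {X Y : I} (f : X ⟶ Y) :
    (eta I).map f ≫ (isInverseCategory I).pinv ((eta I).map f) = 𝟙 ((eta I).obj X) := by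
  have h : (isInverseCategory I).pinv ((eta I).map f) = homMk (PreHom.of f).inv :=
    (isInverseCategory I _ _ _).unique ((isInverseCategory I).pinv_spec _)
      (homMk_isPseudoinverse _)
  rw [h]
  exact Quotient.sound (PreHomRel.monic f)

section Lift

variable {C : Type u₁} [Category.{v₁} C] (hC : IsInverseCategory C) (F : I ⥤ C)

/-- The value of a formal composite in an inverse category. -/
noncomputable def eval : ∀ {X Y : I}, PreHom I X Y → (F.obj X ⟶ F.obj Y)
  | _, _, .of f => F.map f
  | _, _, .comp p q => eval p ≫ eval q
  | _, _, .inv p => hC.pinv (eval p)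

theorem eval_rel (hF : ∀ {X Y : I} (f : X ⟶ Y), F.map f ≫ hC.pinv (F.map f) = 𝟙 (F.obj X))
    {X Y : I} {p q : PreHom I X Y} (h : PreHomRel p q) : eval hC F p = eval hC F q := by
  have idem : ∀ {A B : C} (a : A ⟶ B), (a ≫ hC.pinv a) ≫ (a ≫ hC.pinv a) = a ≫ hC.pinv a :=
    fun a => by rw [Category.assoc, (hC.pinv_spec a).2]
  induction h with
  | refl => rfl
  | symm _ ih => exact ih.symm
  | trans _ _ ih ih' => exact ih.trans ih'
  | comp_congr _ _ ih ih' => simp only [eval, ih, ih']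
  | inv_congr _ ih => simp only [eval, ih]
  | assoc => simp [eval]
  | id_comp => simp [eval]
  | comp_id => simp [eval]
  | of_comp => simp [eval]
  | inv_inv p => exact (hC _ _ _).unique (hC.pinv_spec _) (hC.pinv_spec _).symm
  | comp_inv_comp p => exact (hC.pinv_spec _).1
  | idem_comm p q => exact hC.idem_comm (idem _) (idem _)
  | monic f => simp only [eval, hF, F.map_id]

/-- The extension to `L(I)` of a functor to an inverse category. -/
noncomputable def lift
    (hF : ∀ {X Y : I} (f : X ⟶ Y), F.map f ≫ hC.pinv (F.map f) = 𝟙 (F.obj X)) :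
    LeftFundamental I ⥤ C where
  obj X := F.obj X.as
  map f := Quotient.lift (eval hC F) (fun _ _ h => eval_rel hC F hF h) f
  map_id X := F.map_id X.as
  map_comp f g := Quotient.inductionOn₂ f g fun _ _ => rfl

/-- The universal property of `L(I)`: every functor `F` from `I` to an inverse category with
`F(i)⁻¹ ∘ F(i) = 1` for all arrows `i` factors uniquely through `η`. -/
theorem existsUnique_lift
    (hF : ∀ {X Y : I} (f : X ⟶ Y), F.map f ≫ hC.pinv (F.map f) = 𝟙 (F.obj X)) :
    ∃! G : LeftFundamental I ⥤ C, eta I ⋙ G = F := by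
  refine ⟨lift hC F hF, rfl, ?_⟩
  rintro G rfl
  refine CategoryTheory.Functor.hext (fun X => rfl) ?_
  rintro ⟨X⟩ ⟨Y⟩ f
  obtain ⟨(p : PreHom I X Y), rfl⟩ := homMk_surjective f
  refine heq_of_eq ?_
  change G.map (homMk p) = eval hC (eta I ⋙ G) p
  induction p with
  | of f => rfl
  | comp p q ihp ihq => rw [homMk_comp, G.map_comp, ihp, ihq]; rfl
  | inv p ih =>
    refine (hC _ _ (G.map (homMk p))).unique ?_ ?_
    · obtain ⟨h1, h2⟩ := homMk_isPseudoinverse p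
      constructor
      · rw [← G.map_comp, ← G.map_comp, h1]
      · rw [← G.map_comp, ← G.map_comp, h2]
    · rw [ih]
      exact hC.pinv_spec _

end Lift

end LeftFundamental

variable (I) in
/-- `I` is upward-simply-connected: every endomorphism in `L(I)` is idempotent. -/
def IsUpwardSimplyConnected : Prop :=
  IsIdempotentCategory (LeftFundamental I)

end LeftFundamental

/-! ### Tree-like and forest-like posets -/

section TreeLike

variable {n : ℕ} (K : Fin n → Type u) [∀ k, PartialOrder (K k)] (U : ∀ k, UpperSet (K k))

/-- The disjoint union of the posets `K k`, together with one more point `bot`. -/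
inductive AdjoinPoint (U : ∀ k, UpperSet (K k)) : Type u
  | bot : AdjoinPoint U
  | incl (k : Fin n) (x : K k) : AdjoinPoint U

variable {K}

/-- The order on the disjoint union of the `K k` with one point adjoined that lies below the
elements of each `U k` (and below no other element of the `K k`). -/
inductive AdjoinPoint.Le : AdjoinPoint K U → AdjoinPoint K U → Prop
  | bot_bot : Le .bot .bot
  | bot_incl (k : Fin n) (x : K k) : x ∈ U k → Le .bot (.incl k x)
  | incl_incl (k : Fin n) (x y : K k) : x ≤ y → Le (.incl k x) (.incl k y)

instance : PartialOrder (AdjoinPoint K U) where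
  le := AdjoinPoint.Le U
  le_refl
    | .bot => .bot_bot
    | .incl k x => .incl_incl k x x le_rfl
  le_trans a b c hab hbc := by
    cases hab with
    | bot_bot => exact hbc
    | bot_incl k x hx =>
      cases hbc with
      | incl_incl _ _ y hxy => exact .bot_incl k y ((U k).upper hxy hx)
    | incl_incl k x y hxy =>
      cases hbc with
      | incl_incl _ _ z hyz => exact .incl_incl k x z (hxy.trans hyz)
  le_antisymm a b hab hba := by
    cases hab with
    | bot_bot => rfl
    | bot_incl k x hx => cases hba
    | incl_incl k x y hxy =>
      cases hba with
      | incl_incl _ _ _ hyx => rw [le_antisymm hxy hyx]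

/-- Finite tree-like posets: the class of posets (closed under isomorphism) generated by the rule
that, if `K₁, …, Kₙ` are tree-like and `Uₖ ⊆ Kₖ` are connected upward-closed subsets, then the
disjoint union of the `Kₖ` with a single point adjoined below each `Uₖ` is tree-like.
Connected posets are nonempty. -/
inductive IsTreeLike : ∀ (P : Type u) [PartialOrder P], Prop
  | mk {P : Type u} [PartialOrder P] {n : ℕ} (K : Fin n → Type u) [∀ k, PartialOrder (K k)]
      (U : ∀ k, UpperSet (K k)) (hK : ∀ k, IsTreeLike (K k))
      (hU : ∀ k, CategoryTheory.IsConnected (U k : Set (K k))) (e : P ≃o AdjoinPoint K U) : IsTreeLike P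

/-- Finite forest-like posets: finite disjoint unions of tree-like posets. -/
def IsForestLike (P : Type u) [PartialOrder P] : Prop :=
  ∃ (n : ℕ) (K : Fin n → Type u) (_ : ∀ k, PartialOrder (K k)),
    (∀ k, IsTreeLike (K k)) ∧ Nonempty (P ≃o Σ k, K k)

end TreeLike

end AmalgamableShapes

open AmalgamableShapes

/-!
An `I`-shaped diagram of injections has a cocone iff its colimit in sets identifies no two elements
of the same set `F(X)`. These identifications are the action of the endomorphisms of `L(I)` by
partial injections, so idempotent endomorphisms make them trivial. Conversely, `L(I)` acts on its
own hom-sets, giving for every `Z` the diagram of injections `X ↦ L(I)(Z, X)`. A cocone over it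
identifies `f ∘ f⁻¹` with `f⁻¹` for every endomorphism `f`, and as its legs are injective, `f` is
idempotent. As `L(I)` is countable, the hom-sets can be padded to copies of `ℕ`, which places the
diagram in a category with the AP and the JEP.

For a poset, diagrams of injections over an upward-closed subset `U` extend by the empty set, so `U`
is again upward-simply-connected; mapping `L(U)` to the free groupoid, where all idempotents are
identities, shows that `U` is simply-connected. If all upward-closed subsets are simply-connected,
remove a minimal point `b` from a connected one. In each component of the rest, the elements above
`b` are connected: otherwise the arrows out of `b` into one part of them, given a nontrivial value
in a free group, would define a cocycle which has no potential. This gives the forest decomposition,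
along which cocones are built by amalgamation.

An arbitrary `I` is reduced to its poset reflection: a category with the AP can be replaced by its
quotient in which all morphisms are monic, and there parallel arrows of a diagram become equal.
-/

namespace AmalgamableShapes

/-! ### Cocones over diagrams of injections -/

namespace Inj

instance : ConcreteCategory Inj.{w} fun X Y => X.carrier ↪ Y.carrier where
  hom f := f
  ofHom f := f

theorem injective_hom {X Y : Inj.{w}} (f : X ⟶ Y) : Function.Injective f :=
  (ConcreteCategory.hom f).injective

variable {I : Type u} [Category.{v} I]

/-- The cocone of sets, in any universe, underlying a cocone of injections. -/
def coconeTypes {F : I ⥤ Inj.{w}} (s : Cocone F) : (F ⋙ forget Inj).CoconeTypes where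
  pt := s.pt.carrier
  ι X := s.ι.app X
  ι_naturality f := funext fun x => s.w_apply f x

theorem injective_ιColimitType {F : I ⥤ Inj.{w}} (c : (F ⋙ forget Inj).CoconeTypes)
    (hc : ∀ X, Function.Injective (c.ι X)) (X : I) :
    Function.Injective ((F ⋙ forget Inj).ιColimitType X) :=
  fun _ _ hxy => hc X (congrArg ((F ⋙ forget Inj).descColimitType c) hxy)

theorem nonempty_cocone_iff [Small.{w} I] {F : I ⥤ Inj.{w}} :
    Nonempty (Cocone F) ↔ ∀ X, Function.Injective ((F ⋙ forget Inj).ιColimitType X) := by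
  constructor
  · rintro ⟨s⟩
    exact injective_ιColimitType (coconeTypes s) fun X => injective_hom (s.ι.app X)
  · intro h
    let e := equivShrink.{w} (F ⋙ forget Inj).ColimitType
    exact ⟨⟨Shrink.{w} (F ⋙ forget Inj).ColimitType⟩,
      fun X => ConcreteCategory.ofHom ⟨fun x => e _, e.injective.comp (h X)⟩,
      fun X Y f => ConcreteCategory.hom_ext _ _ fun x =>
        congrArg e ((F ⋙ forget Inj).ιColimitType_map f x)⟩

theorem nonempty_cocone_of_coconeTypes [Small.{w} I] {F : I ⥤ Inj.{w}}
    (c : (F ⋙ forget Inj).CoconeTypes) (hc : ∀ X, Function.Injective (c.ι X)) :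
    Nonempty (Cocone F) :=
  nonempty_cocone_iff.2 (injective_ιColimitType c hc)

/-- Lifting of sets to a larger universe. -/
def uliftFunctor : Inj.{w} ⥤ Inj.{max w u} where
  obj X := ⟨ULift.{u} X.carrier⟩
  map f := ConcreteCategory.ofHom
    ⟨fun x => ⟨f x.down⟩, fun _ _ h => ULift.ext _ _ (injective_hom f (congrArg ULift.down h))⟩

theorem everyDiagramHasCocone_of_ulift [Small.{w} I]
    (h : EveryDiagramHasCocone I Inj.{max w u₁}) : EveryDiagramHasCocone I Inj.{w} := by
  intro F
  obtain ⟨s⟩ := h (F ⋙ uliftFunctor)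
  refine nonempty_cocone_of_coconeTypes
    ((coconeTypes s).precompose (fun _ => ULift.up) fun _ => rfl) fun X x y hxy => ?_
  exact congrArg ULift.down (injective_hom (s.ι.app X) hxy)

end Inj

/-! ### Reduction to diagrams of finite sets -/

section FiniteSets

variable {I : Type u} [Category.{v} I]

/-- The subfunctor generated by a single element. -/
def orbitSubfunctor (T : I ⥤ Type w) {X : I} (x : T.obj X) : Subfunctor T where
  obj Y := Set.range fun f : X ⟶ Y => T.map f x
  map {Y Z} g := by
    rintro _ ⟨f, rfl⟩
    exact ⟨f ≫ g, by simp⟩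

/-- Two elements lie in the subfunctor `G` and have the same image in its colimit. -/
def GluedIn {T : I ⥤ Type w} (G : Subfunctor T) (a b : Σ X, T.obj X) : Prop :=
  ∃ (ha : a.2 ∈ G.obj a.1) (hb : b.2 ∈ G.obj b.1),
    G.toFunctor.ιColimitType a.1 ⟨a.2, ha⟩ = G.toFunctor.ιColimitType b.1 ⟨b.2, hb⟩

variable {T : I ⥤ Type w} {a b : Σ X, T.obj X}

theorem GluedIn.mono {G H : Subfunctor T} (hGH : G ≤ H) (h : GluedIn G a b) : GluedIn H a b := by
  obtain ⟨ha, hb, hab⟩ := h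
  let c : G.toFunctor.CoconeTypes :=
    H.toFunctor.coconeTypes.precompose (fun X => (Subfunctor.homOfLe hGH).app X) fun _ => rfl
  exact ⟨hGH _ ha, hGH _ hb, congrArg (G.toFunctor.descColimitType c) hab⟩

theorem gluedIn_orbitSubfunctor (h : T.ColimitTypeRel a b) :
    GluedIn (orbitSubfunctor T a.2) a b := by
  obtain ⟨f, hf⟩ := h
  have ha : a.2 ∈ (orbitSubfunctor T a.2).obj a.1 := ⟨𝟙 _, by simp⟩
  exact ⟨ha, ⟨f, hf.symm⟩, Quot.sound ⟨f, Subtype.ext hf⟩⟩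

theorem exists_finite_gluedIn [∀ X Y : I, Finite (X ⟶ Y)]
    (h : Relation.EqvGen T.ColimitTypeRel a b) :
    ∃ G : Subfunctor T, (∀ X, (G.obj X).Finite) ∧ GluedIn G a b := by
  have orbit_finite (a : Σ X, T.obj X) (X : I) : ((orbitSubfunctor T a.2).obj X).Finite :=
    Set.finite_range _
  induction h with
  | rel a b hab => exact ⟨_, orbit_finite a, gluedIn_orbitSubfunctor hab⟩
  | refl a => exact ⟨_, orbit_finite a, gluedIn_orbitSubfunctor ⟨𝟙 _, by simp⟩⟩
  | symm a b _ ih =>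
    obtain ⟨G, hG, ha, hb, hab⟩ := ih
    exact ⟨G, hG, hb, ha, hab.symm⟩
  | trans a b c _ _ ih ih' =>
    obtain ⟨G, hG, hab⟩ := ih
    obtain ⟨H, hH, hbc⟩ := ih'
    obtain ⟨ha, _, hab⟩ := hab.mono (le_sup_left : G ≤ G ⊔ H)
    obtain ⟨_, hc, hbc⟩ := hbc.mono (le_sup_right : H ≤ G ⊔ H)
    exact ⟨G ⊔ H, fun X => (hG X).union (hH X), ha, hc, hab.trans hbc⟩

/-- The diagram of injections carried by a subfunctor of the underlying diagram of sets. -/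
def Inj.subdiagram (F : I ⥤ Inj.{w}) (G : Subfunctor (F ⋙ forget Inj)) : I ⥤ Inj.{w} where
  obj X := ⟨G.obj X⟩
  map f := ConcreteCategory.ofHom
    ⟨G.toFunctor.map f, fun _ _ h =>
      Subtype.ext (Inj.injective_hom (F.map f) (congrArg Subtype.val h))⟩
  map_id X := ConcreteCategory.hom_ext _ _ fun x =>
    Subtype.ext (ConcreteCategory.congr_hom (F.map_id X) x.1)
  map_comp f g := ConcreteCategory.hom_ext _ _ fun x =>
    Subtype.ext (ConcreteCategory.congr_hom (F.map_comp f g) x.1)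

theorem everyDiagramHasCocone_inj_of_finite [Small.{w} I] [∀ X Y : I, Finite (X ⟶ Y)]
    (h : ∀ F : I ⥤ Inj.{w}, (∀ X, Finite (F.obj X).carrier) → Nonempty (Cocone F)) :
    EveryDiagramHasCocone I Inj.{w} := by
  refine fun F => Inj.nonempty_cocone_iff.2 fun X x y hxy => ?_
  obtain ⟨G, hG, hx, hy, hxy⟩ := exists_finite_gluedIn (Quot.eqvGen_exact hxy)
  have hinj := Inj.nonempty_cocone_iff.1 (h (Inj.subdiagram F G) hG) X
  exact congrArg Subtype.val (hinj hxy)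

end FiniteSets

/-! ### Inverse categories -/

section InverseCategory

variable {C : Type u₁} [Category.{v₁} C] (hC : IsInverseCategory C)

theorem IsPseudoinverse.map {D : Type u} [Category.{v} D] {X Y : C} {f : X ⟶ Y} {g : Y ⟶ X}
    (h : IsPseudoinverse f g) (F : C ⥤ D) : IsPseudoinverse (F.map f) (F.map g) := by
  simp only [IsPseudoinverse, ← F.map_comp, h.1, h.2, and_self]

namespace IsInverseCategory

include hC

theorem eq_pinv {X Y : C} {f : X ⟶ Y} {g : Y ⟶ X} (h : IsPseudoinverse f g) : g = hC.pinv f :=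
  (hC X Y f).unique h (hC.pinv_spec f)

@[simp]
theorem pinv_pinv {X Y : C} (f : X ⟶ Y) : hC.pinv (hC.pinv f) = f :=
  (hC.eq_pinv (hC.pinv_spec f).symm).symm

@[simp]
theorem comp_pinv_comp {X Y : C} (f : X ⟶ Y) : f ≫ hC.pinv f ≫ f = f := (hC.pinv_spec f).1

@[simp]
theorem pinv_comp_pinv {X Y : C} (f : X ⟶ Y) : hC.pinv f ≫ f ≫ hC.pinv f = hC.pinv f :=
  (hC.pinv_spec f).2

theorem comp_pinv_idem {X Y : C} (f : X ⟶ Y) :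
    (f ≫ hC.pinv f) ≫ f ≫ hC.pinv f = f ≫ hC.pinv f := by
  simp

theorem pinv_comp_idem {X Y : C} (f : X ⟶ Y) :
    (hC.pinv f ≫ f) ≫ hC.pinv f ≫ f = hC.pinv f ≫ f := by
  simp

theorem domain_comm {X Y Z : C} (f : X ⟶ Y) (g : Y ⟶ Z) :
    hC.pinv f ≫ f ≫ g ≫ hC.pinv g = g ≫ hC.pinv g ≫ hC.pinv f ≫ f := by
  simpa using hC.idem_comm (hC.pinv_comp_idem f) (hC.comp_pinv_idem g)

theorem pinv_comp {X Y Z : C} (f : X ⟶ Y) (g : Y ⟶ Z) :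
    hC.pinv (f ≫ g) = hC.pinv g ≫ hC.pinv f := by
  refine (hC.eq_pinv ⟨?_, ?_⟩).symm
  · calc (f ≫ g) ≫ (hC.pinv g ≫ hC.pinv f) ≫ f ≫ g
        = f ≫ (g ≫ hC.pinv g ≫ hC.pinv f ≫ f) ≫ g := by
          simp only [Category.assoc]
      _ = (f ≫ hC.pinv f ≫ f) ≫ g ≫ hC.pinv g ≫ g := by
          rw [← hC.domain_comm]; simp only [Category.assoc]
      _ = f ≫ g := by simp only [comp_pinv_comp]
  · calc (hC.pinv g ≫ hC.pinv f) ≫ (f ≫ g) ≫ hC.pinv g ≫ hC.pinv f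
        = hC.pinv g ≫ (hC.pinv f ≫ f ≫ g ≫ hC.pinv g) ≫ hC.pinv f := by
          simp only [Category.assoc]
      _ = (hC.pinv g ≫ g ≫ hC.pinv g) ≫ hC.pinv f ≫ f ≫ hC.pinv f := by
          rw [hC.domain_comm]; simp only [Category.assoc]
      _ = hC.pinv g ≫ hC.pinv f := by simp only [pinv_comp_pinv]

end IsInverseCategory

theorem map_pinv {D : Type u} [Category.{v} D] (hD : IsInverseCategory D) (F : C ⥤ D) {X Y : C}
    (f : X ⟶ Y) : F.map (hC.pinv f) = hD.pinv (F.map f) :=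
  hD.eq_pinv ((hC.pinv_spec f).map F)

theorem LeftFundamental.eq_top_of_map_eta {I : Type u} [Category.{v} I]
    (W : MorphismProperty (LeftFundamental I)) [W.IsStableUnderComposition]
    (heta : ∀ {X Y : I} (f : X ⟶ Y), W ((eta I).map f))
    (hpinv : ∀ {X Y} (f : X ⟶ Y), W f → W ((isInverseCategory I).pinv f)) : W = ⊤ := by
  suffices ∀ {X Y : I} (p : PreHom I X Y), W (homMk p) by
    ext X Y f
    obtain ⟨p, rfl⟩ := homMk_surjective f
    exact ⟨fun _ => trivial, fun _ => this p⟩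
  intro X Y p
  induction p with
  | of f => exact heta f
  | comp p q hp hq => exact W.comp_mem _ _ hp hq
  | inv p hp =>
    rw [(isInverseCategory I).eq_pinv (homMk_isPseudoinverse p)]
    exact hpinv _ hp

end InverseCategory

/-! ### Partial injections -/

/-- A set, as an object of the inverse category of sets and partial injections. -/
structure PInj : Type (w + 1) where
  /-- The underlying set. -/
  carrier : Type w

namespace PInj

instance : Category.{w} PInj.{w} where
  Hom X Y := X.carrier ≃. Y.carrier
  id X := PEquiv.refl X.carrier
  comp f g := f.trans g
  id_comp := PEquiv.refl_trans
  comp_id := PEquiv.trans_refl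
  assoc := PEquiv.trans_assoc

/-- The partial equivalence underlying a morphism of `PInj`. -/
abbrev toPEquiv {X Y : PInj.{w}} (f : X ⟶ Y) : X.carrier ≃. Y.carrier := f

theorem trans_symm_trans {α β : Type w} (f : α ≃. β) : f.trans (f.symm.trans f) = f := by
  refine PEquiv.ext fun a => Option.ext fun b => ?_
  simp only [← Option.mem_def, PEquiv.mem_trans, PEquiv.mem_iff_mem]
  constructor
  · rintro ⟨b', hb', a', ha', hb⟩
    rwa [f.inj hb' ha']
  · exact fun hb => ⟨b, hb, a, hb, hb⟩

theorem eq_of_mem_of_trans_self {α : Type w} {e : α ≃. α} (he : e.trans e = e) {a b : α}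
    (h : b ∈ e a) : a = b := by
  obtain ⟨c, hac, hcb⟩ := (e.mem_trans e a b).1 (he.symm ▸ h)
  obtain rfl : b = c := Option.mem_unique h hac
  exact e.inj h hcb

theorem mem_trans_comm {α : Type w} {e f : α ≃. α} (he : e.trans e = e) (hf : f.trans f = f)
    {a b : α} (h : b ∈ e.trans f a) : b ∈ f.trans e a := by
  obtain ⟨c, hac, hcb⟩ := (e.mem_trans f a b).1 h
  obtain rfl := eq_of_mem_of_trans_self he hac
  obtain rfl := eq_of_mem_of_trans_self hf hcb
  exact (f.mem_trans e _ _).2 ⟨_, hcb, hac⟩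

theorem isPseudoinverse_symm {X Y : PInj.{w}} (f : X ⟶ Y) :
    IsPseudoinverse f ((toPEquiv f).symm : Y ⟶ X) :=
  ⟨trans_symm_trans f, trans_symm_trans (toPEquiv f).symm⟩

theorem isInverseCategory : IsInverseCategory PInj.{w} := by
  refine isInverseCategory_of_idem_comm (fun X Y f => ⟨_, isPseudoinverse_symm f⟩) ?_
  exact fun X e f he hf => PEquiv.ext fun a => Option.ext fun b =>
    ⟨mem_trans_comm he hf, mem_trans_comm hf he⟩

variable {I : Type u} [Category.{v} I]

/-- Injections, regarded as everywhere defined partial injections. -/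
noncomputable def ofInj : Inj.{w} ⥤ PInj.{w} where
  obj X := ⟨X.carrier⟩
  map f :=
    { toFun := fun x => some (f x)
      invFun := Function.partialInv f
      inv := fun x y => by
        simpa [eq_comm] using (Inj.injective_hom f).isPartialInv x y }
  map_id X := PEquiv.ext fun x => rfl
  map_comp f g := PEquiv.ext fun x => rfl

theorem ofInj_map_comp_pinv {X Y : Inj.{w}} (f : X ⟶ Y) :
    ofInj.map f ≫ isInverseCategory.pinv (ofInj.map f) = 𝟙 (ofInj.obj X) := by
  rw [← isInverseCategory.eq_pinv (isPseudoinverse_symm _)]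
  exact PEquiv.trans_symm_eq_iff_forall_isSome.2 fun _ => rfl

/-- The action of `L(I)` on a diagram of injections by partial injections. -/
noncomputable def action (F : I ⥤ Inj.{w}) : LeftFundamental I ⥤ PInj.{w} :=
  LeftFundamental.lift isInverseCategory (F ⋙ ofInj) fun f => ofInj_map_comp_pinv (F.map f)

theorem exists_mem_action_map {F : I ⥤ Inj.{w}} {a b : Σ X, (F.obj X).carrier}
    (h : Relation.EqvGen (F ⋙ forget Inj).ColimitTypeRel a b) :
    ∃ p : (⟨a.1⟩ : LeftFundamental I) ⟶ ⟨b.1⟩,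
      b.2 ∈ toPEquiv ((action F).map p) a.2 := by
  induction h with
  | rel a b h =>
    obtain ⟨f, hf⟩ := h
    exact ⟨(LeftFundamental.eta I).map f, congrArg some hf.symm⟩
  | refl a =>
    refine ⟨𝟙 _, ?_⟩
    rw [(action F).map_id]
    rfl
  | symm a b _ ih =>
    obtain ⟨p, hp⟩ := ih
    refine ⟨(LeftFundamental.isInverseCategory I).pinv p, ?_⟩
    rw [map_pinv _ isInverseCategory, ← isInverseCategory.eq_pinv (isPseudoinverse_symm _)]
    exact (PEquiv.mem_iff_mem _).2 hp
  | trans a b c _ _ ih ih' =>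
    obtain ⟨p, hp⟩ := ih
    obtain ⟨q, hq⟩ := ih'
    refine ⟨p ≫ q, ?_⟩
    rw [(action F).map_comp]
    exact (PEquiv.mem_trans _ _ _ _).2 ⟨_, hp, hq⟩

end PInj

theorem IsUpwardSimplyConnected.everyDiagramHasCocone_inj {I : Type u} [Category.{v} I]
    [Small.{w} I] (h : IsUpwardSimplyConnected I) : EveryDiagramHasCocone I Inj.{w} := by
  refine fun F => Inj.nonempty_cocone_iff.2 fun X x y hxy => ?_
  obtain ⟨p, hp⟩ := PInj.exists_mem_action_map (Quot.eqvGen_exact hxy)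
  refine PInj.eq_of_mem_of_trans_self ?_ hp
  exact ((PInj.action F).map_comp p p).symm.trans (congrArg _ (h _ p))

/-! ### Diagrams of hom-sets -/

section HomDiagram

variable {C : Type u₁} [Category.{v₁} C]

/-- The diagram `X ↦ (Z ⟶ F X)` of sets and injections. -/
def homDiagram {I : Type u} [Category.{v} I] (F : I ⥤ C)
    [∀ {X Y : I} (f : X ⟶ Y), Mono (F.map f)] (Z : C) : I ⥤ Inj.{v₁} where
  obj X := ⟨Z ⟶ F.obj X⟩
  map f := ConcreteCategory.ofHom ⟨fun g => g ≫ F.map f, fun _ _ => (cancel_mono (F.map f)).1⟩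
  map_id X := ConcreteCategory.hom_ext _ _ fun (g : Z ⟶ F.obj X) => by
    change g ≫ F.map (𝟙 X) = g
    simp
  map_comp {X _ _} f f' := ConcreteCategory.hom_ext _ _ fun (g : Z ⟶ F.obj X) => by
    change g ≫ F.map (f ≫ f') = (g ≫ F.map f) ≫ F.map f'
    simp

/-- For maps `c X : (Z ⟶ X) → A`, the morphisms `f` such that `c` is constant under composition
with `f` on the morphisms `g` whose image is contained in the domain `f⁻¹ ∘ f` of `f`. -/
def constantAlong (hC : IsInverseCategory C) {Z : C} {A : Type w} (c : ∀ X, (Z ⟶ X) → A) :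
    MorphismProperty C :=
  fun X Y f => ∀ g : Z ⟶ X, g ≫ f ≫ hC.pinv f = g → c Y (g ≫ f) = c X g

variable (hC : IsInverseCategory C) {Z : C} {A : Type w} (c : ∀ X, (Z ⟶ X) → A)

instance constantAlong_isStableUnderComposition :
    (constantAlong hC c).IsStableUnderComposition where
  comp_mem {X Y T} f h hf hh g hg := by
    rw [hC.pinv_comp, Category.assoc] at hg
    have hgf : g ≫ f ≫ hC.pinv f = g := by
      rw [← hg]; simp
    have hgfh : (g ≫ f) ≫ h ≫ hC.pinv h = g ≫ f := by
      calc (g ≫ f) ≫ h ≫ hC.pinv h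
          = g ≫ (f ≫ hC.pinv f ≫ f) ≫ h ≫ hC.pinv h := by
            rw [hC.comp_pinv_comp, Category.assoc]
        _ = g ≫ f ≫ hC.pinv f ≫ f ≫ h ≫ hC.pinv h := by simp only [Category.assoc]
        _ = (g ≫ f ≫ h ≫ hC.pinv h ≫ hC.pinv f) ≫ f := by
            rw [hC.domain_comm]; simp only [Category.assoc]
        _ = g ≫ f := by rw [hg]
    calc c T (g ≫ f ≫ h) = c T ((g ≫ f) ≫ h) := by rw [Category.assoc]
      _ = c Y (g ≫ f) := hh _ hgfh
      _ = c X g := hf g hgf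

theorem constantAlong_pinv {X Y : C} {f : X ⟶ Y} (hf : constantAlong hC c f) :
    constantAlong hC c (hC.pinv f) := by
  intro g hg
  have hgf : (g ≫ hC.pinv f) ≫ f = g := by simpa using hg
  have := hf (g ≫ hC.pinv f) (by simp)
  rw [← this, hgf]

instance LeftFundamental.mono_eta_map {I : Type u} [Category.{v} I] {X Y : I} (f : X ⟶ Y) :
    Mono ((eta I).map f) :=
  mono_of_mono_fac (eta_monic I f)

open LeftFundamental in
theorem isUpwardSimplyConnected_of_nonempty_cocone {I : Type u} [Category.{v} I]
    (h : ∀ Z, Nonempty (Cocone (homDiagram (eta I) Z))) : IsUpwardSimplyConnected I := by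
  intro X f
  have hL := LeftFundamental.isInverseCategory I
  obtain ⟨s⟩ := h X
  let c (Y : LeftFundamental I) : (X ⟶ Y) → s.pt.carrier := fun g => s.ι.app Y.as g
  have hc : constantAlong hL c = ⊤ :=
    eq_top_of_map_eta _ (fun f g _ => s.w_apply f g) fun f => constantAlong_pinv hL c
  have hcf : c X (hL.pinv f ≫ f) = c X (hL.pinv f) :=
    MorphismProperty.of_eq_top hc f _ (by simp)
  have hf : hL.pinv f ≫ f = hL.pinv f := Inj.injective_hom (s.ι.app X.as) hcf
  calc f ≫ f = (f ≫ hL.pinv f ≫ f) ≫ f := by rw [hL.comp_pinv_comp]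
    _ = f ≫ hL.pinv f ≫ f := by rw [hf, Category.assoc, hf]
    _ = f := hL.comp_pinv_comp f

end HomDiagram

/-! ### Finitely generated categories -/

section FinitelyGenerated

theorem exists_countable_closed {α : Type*} {op : α → α → Set α}
    (hop : ∀ a b, (op a b).Countable) {S : Set α} (hS : S.Countable) :
    ∃ T : Set α, T.Countable ∧ S ⊆ T ∧ ∀ a ∈ T, ∀ b ∈ T, op a b ⊆ T := by
  let stage : ℕ → Set α := Nat.rec S fun _ T => T ∪ ⋃ a ∈ T, ⋃ b ∈ T, op a b
  have hmono : Monotone stage := monotone_nat_of_le_succ fun n => Set.subset_union_left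
  refine ⟨⋃ n, stage n, Set.countable_iUnion fun n => ?_, Set.subset_iUnion stage 0, ?_⟩
  · induction n with
    | zero => exact hS
    | succ n ih => exact ih.union (ih.biUnion fun a _ => ih.biUnion fun b _ => hop a b)
  · intro a ha b hb c hc
    obtain ⟨m, ha⟩ := Set.mem_iUnion.1 ha
    obtain ⟨n, hb⟩ := Set.mem_iUnion.1 hb
    refine Set.mem_iUnion.2 ⟨max m n + 1, Or.inr ?_⟩
    exact Set.mem_biUnion (hmono (le_max_left _ _) ha)
      (Set.mem_biUnion (hmono (le_max_right _ _) hb) hc)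

theorem IsInverseCategory.exists_countable_closed {C : Type u₁} [Category.{v₁} C]
    (hC : IsInverseCategory C) {W : MorphismProperty C} (hW : W.toSet.Countable) :
    ∃ W' : MorphismProperty C, W'.toSet.Countable ∧ W ≤ W' ∧ W'.IsStableUnderComposition ∧
      ∀ {X Y : C} (f : X ⟶ Y), W' f → W' (hC.pinv f) := by
  let op (f g : Arrow C) : Set (Arrow C) :=
    insert (Arrow.mk (hC.pinv f.hom))
      (Set.range fun e : f.right = g.left => Arrow.mk (f.hom ≫ eqToHom e ≫ g.hom))
  obtain ⟨T, hT, hWT, hcl⟩ := AmalgamableShapes.exists_countable_closed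
    (op := op) (fun f g => (Set.countable_range _).insert _) hW
  refine ⟨fun X Y f => Arrow.mk f ∈ T, hT.mono fun f hf => hf, fun X Y f hf => hWT hf,
    ⟨fun f g hf hg => hcl _ hf _ hg (Or.inr ⟨rfl, ?_⟩)⟩, fun f hf => hcl _ hf _ hf (Or.inl rfl)⟩
  exact congrArg Arrow.mk (congrArg (f ≫ ·) (Category.id_comp g))

variable {I : Type u} [Category.{v} I]

theorem IsFinitelyGenerated.finite (h : IsFinitelyGenerated I) : Finite I := by
  obtain ⟨W, hW, hgen⟩ := h
  let source : MorphismProperty I := fun X _ _ => X ∈ (fun f : Arrow I => f.left) '' W.toSet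
  have hsource : source = ⊤ :=
    hgen source ⟨fun _ _ hf _ => hf⟩ fun X Y f hf => ⟨Arrow.mk f, hf, rfl⟩
  refine Set.finite_univ_iff.1 ((hW.image fun f : Arrow I => f.left).subset fun X _ => ?_)
  exact MorphismProperty.of_eq_top hsource (𝟙 X)

open LeftFundamental in
theorem IsFinitelyGenerated.countable_leftFundamental_hom (h : IsFinitelyGenerated I)
    (X Y : LeftFundamental I) : Countable (X ⟶ Y) := by
  obtain ⟨W, hW, hgen⟩ := h
  let generated : MorphismProperty (LeftFundamental I) := fun _ _ g =>
    Arrow.mk g ∈ (eta I).mapArrow.obj '' W.toSet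
  have hgenerated : generated.toSet.Countable :=
    (hW.countable.image (eta I).mapArrow.obj).mono fun g hg => hg
  obtain ⟨T, hT, hWT, hcomp, hpinv⟩ := (isInverseCategory I).exists_countable_closed hgenerated
  have heta : T.inverseImage (eta I) = ⊤ :=
    hgen _ inferInstance fun X Y f hf => hWT _ ⟨Arrow.mk f, hf, rfl⟩
  have hTtop : T = ⊤ := eq_top_of_map_eta T (MorphismProperty.of_eq_top heta) hpinv
  refine Set.countable_univ_iff.1 ((hT.preimage (Arrow.mk_injective X Y)).mono fun f _ => ?_)
  exact MorphismProperty.of_eq_top hTtop f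

theorem isFinitelyGenerated_of_finite [Finite I] [∀ X Y : I, Finite (X ⟶ Y)] :
    IsFinitelyGenerated I := by
  have : Finite (Arrow I) := Finite.of_surjective
    (fun f : Σ X Y : I, (X ⟶ Y) => Arrow.mk f.2.2) fun f => ⟨⟨f.left, f.right, f.hom⟩, rfl⟩
  exact ⟨⊤, Set.toFinite _, fun W' _ hW' => top_le_iff.1 hW'⟩

end FinitelyGenerated

/-! ### The amalgamation and joint embedding properties -/

section Amalgamation

variable {C : Type u₁} [Category.{v₁} C]

theorem amalgamationProperty_iff :
    AmalgamationProperty C ↔ ∀ {X Y Z : C} (f : X ⟶ Y) (g : X ⟶ Z),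
      ∃ (A : C) (h : Y ⟶ A) (k : Z ⟶ A), f ≫ h = g ≫ k := by
  constructor
  · intro H X Y Z f g
    obtain ⟨s⟩ := H (span f g)
    exact ⟨s.pt, s.ι.app WalkingSpan.left, s.ι.app WalkingSpan.right, PushoutCocone.condition s⟩
  · intro H F
    obtain ⟨A, h, k, hk⟩ := H (F.map WalkingSpan.Hom.fst) (F.map WalkingSpan.Hom.snd)
    exact ⟨(Cocone.precompose (diagramIsoSpan F).hom).obj (PushoutCocone.mk h k hk)⟩

theorem jointEmbeddingProperty_iff :
    JointEmbeddingProperty C ↔ ∀ (n : ℕ) (X : Fin n → C), ∃ A, ∀ k, Nonempty (X k ⟶ A) := by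
  constructor
  · intro H n X
    obtain ⟨s⟩ := H n (Discrete.functor X)
    exact ⟨s.pt, fun k => ⟨s.ι.app ⟨k⟩⟩⟩
  · intro H n F
    obtain ⟨A, h⟩ := H n fun k => F.obj ⟨k⟩
    exact ⟨⟨A, Discrete.natTrans fun k => (h k.as).some⟩⟩

theorem AmalgamationProperty.exists_wide (hC : AmalgamationProperty C) {X : C} :
    ∀ {n : ℕ} (A : Fin n → C) (f : ∀ k, X ⟶ A k),
      ∃ (B : C) (g : X ⟶ B) (h : ∀ k, A k ⟶ B), ∀ k, f k ≫ h k = g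
  | 0, _, _ => ⟨X, 𝟙 X, fun k => k.elim0, fun k => k.elim0⟩
  | n + 1, A, f => by
    obtain ⟨B, g, h, hg⟩ := hC.exists_wide (fun k : Fin n => A k.succ) fun k => f k.succ
    obtain ⟨D, i, j, hij⟩ := amalgamationProperty_iff.1 hC (f 0) g
    refine ⟨D, g ≫ j, Fin.cases i fun k => h k ≫ j, Fin.cases hij fun k => ?_⟩
    simp only [Fin.cases_succ, ← Category.assoc, hg]

variable (C) in
theorem amalgamationProperty_of_isGroupoid [IsGroupoid C] : AmalgamationProperty C :=
  amalgamationProperty_iff.2 fun {X _ _} f g => ⟨X, inv f, inv g, by simp⟩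

variable {J : Type u} [Category.{v} J]

theorem EveryDiagramHasCocone.of_equivalence {D : Type*} [Category* D] (e : C ≌ D)
    (h : EveryDiagramHasCocone J C) : EveryDiagramHasCocone J D :=
  fun F => (h (F ⋙ e.inverse)).map (Functor.mapCoconeInv e.inverse)

end Amalgamation

/-! ### Injections of a countably infinite set -/

section NatInj

/-- The monoid of injections of `ℕ` into itself, as a category with a single object. Unlike the
category of countable sets, it lives in the lowest universe. -/
abbrev NatInj : Type := InducedCategory Inj.{0} fun _ : Unit => ⟨ℕ⟩

theorem exists_amalgam {α β γ : Type*} (f : α ↪ β) (g : α ↪ γ) :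
    ∃ k : γ ↪ β ⊕ γ, ∀ a, k (g a) = Sum.inl (f a) := by
  refine ⟨⟨Function.extend g (Sum.inl ∘ f) Sum.inr, ?_⟩, g.injective.extend_apply _ _⟩
  intro c c' h
  by_cases hc : ∃ a, g a = c <;> by_cases hc' : ∃ a, g a = c'
  · obtain ⟨a, rfl⟩ := hc
    obtain ⟨a', rfl⟩ := hc'
    simpa [g.injective.extend_apply] using h
  · obtain ⟨a, rfl⟩ := hc
    simp [g.injective.extend_apply, Function.extend_apply' _ _ _ hc'] at h
  · obtain ⟨a, rfl⟩ := hc'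
    simp [g.injective.extend_apply, Function.extend_apply' _ _ _ hc] at h
  · simpa [Function.extend_apply' _ _ _ hc, Function.extend_apply' _ _ _ hc'] using h

theorem NatInj.amalgamationProperty : AmalgamationProperty NatInj := by
  refine amalgamationProperty_iff.2 fun {X Y Z} f g => ?_
  obtain ⟨k, hk⟩ := exists_amalgam (f.hom : ℕ ↪ ℕ) (g.hom : ℕ ↪ ℕ)
  let e := Equiv.natSumNatEquivNat.toEmbedding
  refine ⟨(), ⟨Function.Embedding.inl.trans e⟩, ⟨k.trans e⟩, InducedCategory.hom_ext ?_⟩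
  exact ConcreteCategory.hom_ext _ _ fun a => congrArg e (hk a).symm

theorem NatInj.jointEmbeddingProperty : JointEmbeddingProperty NatInj :=
  jointEmbeddingProperty_iff.2 fun _ _ => ⟨(), fun _ => ⟨𝟙 _⟩⟩

variable {I : Type u} [Category.{v} I]

theorem nonempty_cocone_of_natInj [Small.{w} I] (F : I ⥤ Inj.{w})
    [∀ X, Countable (F.obj X).carrier]
    (h : ∀ G : I ⥤ NatInj, Nonempty (Cocone (G ⋙ inducedFunctor _))) : Nonempty (Cocone F) := by
  let e (X : I) : (F.obj X).carrier ⊕ ℕ ≃ ℕ := (nonempty_equiv_of_countable).some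
  let padded {X Y : I} (f : X ⟶ Y) : ℕ ↪ ℕ :=
    ((e X).symm.toEmbedding.trans
      ((ConcreteCategory.hom (F.map f)).sumMap (.refl ℕ))).trans (e Y).toEmbedding
  let G : I ⥤ NatInj :=
    { obj _ := ()
      map f := ⟨padded f⟩
      map_id X := InducedCategory.hom_ext <| ConcreteCategory.hom_ext _ _ fun (n : ℕ) => by
        change e X (Sum.map (F.map (𝟙 X)) id ((e X).symm n)) = n
        have hid : ⇑(F.map (𝟙 X)) = id := by rw [F.map_id]; rfl
        simp only [hid, Sum.map_id_id, id_eq, Equiv.apply_symm_apply]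
      map_comp {X Y Z} f g := InducedCategory.hom_ext <|
        ConcreteCategory.hom_ext _ _ fun (n : ℕ) => by
        change e Z (Sum.map (F.map (f ≫ g)) id ((e X).symm n)) =
          e Z (Sum.map (F.map g) id ((e Y).symm (e Y (Sum.map (F.map f) id ((e X).symm n)))))
        have hcomp : ⇑(F.map (f ≫ g)) = F.map g ∘ F.map f := by rw [F.map_comp]; rfl
        simp only [hcomp, Equiv.symm_apply_apply, Sum.map_map, Function.comp_id] }
  obtain ⟨s⟩ := h G
  refine Inj.nonempty_cocone_of_coconeTypes
    ((Inj.coconeTypes s).precompose (fun X x => e X (Sum.inl x)) fun {X Y} f => funext fun x => ?_)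
    fun X x y hxy => ?_
  · change e Y _ = e Y (Sum.map (F.map f) id ((e X).symm (e X (Sum.inl x))))
    rw [Equiv.symm_apply_apply]
    rfl
  · exact Sum.inl_injective ((e X).injective (Inj.injective_hom (s.ι.app X) hxy))

theorem IsFinitelyGenerated.isUpwardSimplyConnected (hI : IsFinitelyGenerated I)
    (h : ∀ G : I ⥤ NatInj, Nonempty (Cocone (G ⋙ inducedFunctor _))) :
    IsUpwardSimplyConnected I := by
  refine isUpwardSimplyConnected_of_nonempty_cocone fun Z => ?_
  have (X : I) : Countable ((homDiagram (LeftFundamental.eta I) Z).obj X).carrier :=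
    hI.countable_leftFundamental_hom _ _
  exact nonempty_cocone_of_natInj _ h

theorem IsUpwardSimplyConnected.of_inj (hI : IsFinitelyGenerated I)
    (h : EveryDiagramHasCocone I Inj.{w}) : IsUpwardSimplyConnected I :=
  have := hI.finite
  have hzero : EveryDiagramHasCocone I Inj.{0} := Inj.everyDiagramHasCocone_of_ulift.{u, v, w, 0} h
  hI.isUpwardSimplyConnected fun _ => hzero _

theorem IsUpwardSimplyConnected.of_amalgamable (hI : IsFinitelyGenerated I)
    (h : ∀ (C : Type u₁) [Category.{v₁} C], AmalgamationProperty C → JointEmbeddingProperty C →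
      EveryDiagramHasCocone I C) : IsUpwardSimplyConnected I := by
  let e : NatInj ≌ ULiftHom.{v₁} (ULift.{u₁} NatInj) := ULiftHomULiftCategory.equiv NatInj
  have hnat : EveryDiagramHasCocone I NatInj :=
    (h _ (.of_equivalence e NatInj.amalgamationProperty)
      fun n => (NatInj.jointEmbeddingProperty n).of_equivalence e).of_equivalence e.symm
  exact hI.isUpwardSimplyConnected fun G => (hnat G).map (inducedFunctor _).mapCocone

end NatInj

/-! ### Simply-connected categories -/

section SimplyConnected

variable {C : Type u} [Category.{v} C]

theorem subgroupoid_eq_top_of_homMk_mem (S : Subgroupoid (FreeGroupoid C))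
    (h : ∀ {X Y : C} (f : X ⟶ Y), FreeGroupoid.homMk f ∈ S.arrows (.mk X) (.mk Y)) : S = ⊤ := by
  let toS : C ⥤ S.objs :=
    { obj X := ⟨.mk X, _, S.id_mem_of_src (h (𝟙 X))⟩
      map f := ⟨FreeGroupoid.homMk f, h f⟩
      map_id X := Subtype.ext ((FreeGroupoid.of C).map_id X)
      map_comp f g := Subtype.ext ((FreeGroupoid.of C).map_comp f g) }
  have hlift : FreeGroupoid.lift toS ⋙ S.hom = 𝟭 (FreeGroupoid C) :=
    (FreeGroupoid.lift_unique (FreeGroupoid.of C) _ rfl).trans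
      (FreeGroupoid.lift_unique (FreeGroupoid.of C) (𝟭 _) rfl).symm
  have hmem {X Y : FreeGroupoid C} (f : X ⟶ Y) :
      (FreeGroupoid.lift toS ⋙ S.hom).map f ∈ S.arrows _ _ :=
    ((FreeGroupoid.lift toS).map f).2
  rw [hlift] at hmem
  ext X Y f
  exact ⟨fun _ => trivial, fun _ => hmem f⟩

theorem isPseudoinverse_iff_eq_inv {G : Type u} [Groupoid.{v} G] {X Y : G} {f : X ⟶ Y}
    {g : Y ⟶ X} : IsPseudoinverse f g ↔ g = Groupoid.inv f := by
  refine ⟨fun h => ?_, fun h => by simp [IsPseudoinverse, h]⟩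
  rw [← cancel_epi f, ← cancel_mono f]
  simpa using h.1

theorem isInverseCategory_of_groupoid (G : Type u) [Groupoid.{v} G] : IsInverseCategory G :=
  fun _ _ f => ⟨Groupoid.inv f, isPseudoinverse_iff_eq_inv.2 rfl,
    fun _ h => isPseudoinverse_iff_eq_inv.1 h⟩

open LeftFundamental in
theorem IsUpwardSimplyConnected.isSimplyConnectedCategory (h : IsUpwardSimplyConnected C) :
    IsSimplyConnectedCategory C := by
  have hL := LeftFundamental.isInverseCategory C
  have hG := isInverseCategory_of_groupoid (FreeGroupoid C)
  let L : LeftFundamental C ⥤ FreeGroupoid C := lift hG (FreeGroupoid.of C) fun f => by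
    rw [isPseudoinverse_iff_eq_inv.1 (hG.pinv_spec _), Groupoid.comp_inv]
  let range : Subgroupoid (FreeGroupoid C) :=
    { arrows X Y := Set.range (L.map : ((⟨X.as.as⟩ : LeftFundamental C) ⟶ ⟨Y.as.as⟩) → (X ⟶ Y))
      inv := by
        rintro X Y _ ⟨f, rfl⟩
        exact ⟨hL.pinv f, isPseudoinverse_iff_eq_inv.1 ((hL.pinv_spec f).map L)⟩
      mul := by
        rintro X Y Z _ ⟨f, rfl⟩ _ ⟨g, rfl⟩
        exact ⟨f ≫ g, L.map_comp f g⟩ }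
  have hrange : range = ⊤ :=
    subgroupoid_eq_top_of_homMk_mem range fun f => ⟨(eta C).map f, rfl⟩
  have eq_id {X : FreeGroupoid C} (f : X ⟶ X) : f = 𝟙 X := by
    obtain ⟨p, rfl⟩ : f ∈ range.arrows X X := hrange ▸ trivial
    have hidem : L.map p ≫ L.map p = L.map p := by rw [← L.map_comp, h]
    exact (cancel_mono (L.map p)).1 (hidem.trans (Category.id_comp _).symm)
  exact (Groupoid.isThin_iff _).2 fun X => ⟨fun f g => (eq_id f).trans (eq_id g).symm⟩

theorem IsSimplyConnectedCategory.exists_potential (h : IsSimplyConnectedCategory C) {G : Type*}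
    [Group G] (F : C ⥤ SingleObj G) :
    ∃ φ : C → G, ∀ {X Y : C} (f : X ⟶ Y), φ Y = (F.map f : G) * φ X := by
  let base (X : C) : FreeGroupoid C :=
    Quotient.out (s := isIsomorphicSetoid _) (Quotient.mk _ (FreeGroupoid.mk X))
  have hbase {X Y : C} (f : X ⟶ Y) : base X = base Y :=
    congrArg Quotient.out (Quotient.sound ⟨asIso (FreeGroupoid.homMk f)⟩)
  have path (X : C) : base X ⟶ FreeGroupoid.mk X :=
    (Nonempty.some (Quotient.mk_out (s := isIsomorphicSetoid _) (FreeGroupoid.mk X))).hom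
  have lift_map {X Y : C} (f : X ⟶ Y) {A B : FreeGroupoid C} (hAB : A = B) (p : A ⟶ .mk X)
      (q : B ⟶ .mk Y) : (FreeGroupoid.lift F).map q = F.map f * (FreeGroupoid.lift F).map p := by
    subst hAB
    rw [(h A (.mk Y)).elim q (p ≫ FreeGroupoid.homMk f), Functor.map_comp,
      FreeGroupoid.lift_map_homMk]
    rfl
  exact ⟨fun X => (FreeGroupoid.lift F).map (path X), fun f => lift_map f (hbase f) _ _⟩

end SimplyConnected

section UpperSet

variable {P : Type u} [PartialOrder P] {U : Set P}

/-- The extension of a diagram of injections on an upper set by empty sets. -/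
def extendByEmpty (hU : IsUpperSet U) (F : U ⥤ Inj.{w}) : P ⥤ Inj.{w} where
  obj x := ⟨Σ' h : x ∈ U, (F.obj ⟨x, h⟩).carrier⟩
  map f := ConcreteCategory.ofHom
    ⟨fun a => ⟨hU (leOfHom f) a.1, F.map (homOfLE (leOfHom f)) a.2⟩, fun ⟨_, _⟩ ⟨_, _⟩ hab =>
      congrArg _ (Inj.injective_hom _ (eq_of_heq (PSigma.mk.inj_iff.1 hab).2))⟩
  map_id _ := ConcreteCategory.hom_ext _ _ fun ⟨h, a⟩ =>
    congrArg (PSigma.mk h) (ConcreteCategory.congr_hom (F.map_id _) a)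
  map_comp _ _ := ConcreteCategory.hom_ext _ _ fun ⟨_, a⟩ =>
    congrArg (PSigma.mk _) (ConcreteCategory.congr_hom (F.map_comp (homOfLE _) (homOfLE _)) a)

theorem EveryDiagramHasCocone.of_isUpperSet [Small.{w} P] (h : EveryDiagramHasCocone P Inj.{w})
    (hU : IsUpperSet U) : EveryDiagramHasCocone U Inj.{w} := by
  intro F
  obtain ⟨s⟩ := h (extendByEmpty hU F)
  refine Inj.nonempty_cocone_of_coconeTypes
    { pt := s.pt.carrier
      ι x a := s.ι.app x.1 ⟨x.2, a⟩
      ι_naturality {x y} f := funext fun a => s.w_apply (homOfLE (leOfHom f)) ⟨x.2, a⟩ }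
    fun x a b hab => ?_
  exact eq_of_heq (PSigma.mk.inj_iff.1 (Inj.injective_hom (s.ι.app x.1) hab)).2

theorem isSimplyConnectedCategory_of_inj [Finite P] (h : EveryDiagramHasCocone P Inj.{w})
    (hU : IsUpperSet U) : IsSimplyConnectedCategory U :=
  (IsUpwardSimplyConnected.of_inj isFinitelyGenerated_of_finite
    (h.of_isUpperSet hU)).isSimplyConnectedCategory

end UpperSet

/-! ### Decomposition of posets with simply-connected upper sets -/

section Decomposition

variable {P : Type u} [PartialOrder P] {S : Set P} {n : ℕ} {K : Fin n → Set P} {b : P}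

/-- The sets `K k` are the connected components of the subset `S` of a poset: they are connected,
cover `S`, and elements of distinct ones are incomparable. -/
structure IsComponents (S : Set P) {n : ℕ} (K : Fin n → Set P) : Prop where
  isConnected (k : Fin n) : CategoryTheory.IsConnected (K k)
  mem_iff (x : P) : x ∈ S ↔ ∃ k, x ∈ K k
  eq_of_le {k l : Fin n} {x y : P} : x ∈ K k → y ∈ K l → x ≤ y → k = l

theorem exists_isComponents (S : Set P) [Finite S] :
    ∃ (n : ℕ) (K : Fin n → Set P), IsComponents S K := by
  have : Finite (ConnectedComponents S) := Quotient.finite _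
  obtain ⟨n, ⟨e⟩⟩ := Finite.exists_equiv_fin (ConnectedComponents S)
  refine ⟨n, fun k => {x | ∃ h : x ∈ S, e (.mk ⟨x, h⟩) = k}, fun k => ?_, fun x => ?_, ?_⟩
  · obtain ⟨c, rfl⟩ := e.surjective k
    have ⟨x₀⟩ : Nonempty c.Component := inferInstance
    have : Nonempty {x | ∃ h : x ∈ S, e (.mk ⟨x, h⟩) = e c} := ⟨x₀.obj, x₀.obj.2, congrArg e x₀.2⟩
    refine IsConnected.of_constant_of_preserves_morphisms fun φ hφ x y => ?_
    exact constant_of_preserves_morphisms (J := c.Component)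
      (fun z => φ ⟨z.obj, z.obj.2, congrArg e z.2⟩)
      (fun _ _ f => hφ (homOfLE (leOfHom (c.ι.map f))))
      ⟨⟨x, x.2.1⟩, e.injective x.2.2⟩ ⟨⟨y, y.2.1⟩, e.injective y.2.2⟩
  · exact ⟨fun hx => ⟨_, hx, rfl⟩, fun ⟨_, hx, _⟩ => hx⟩
  · rintro _ _ x y ⟨hx, rfl⟩ ⟨hy, rfl⟩ hxy
    exact congrArg e (Quotient.sound (Zigzag.of_hom (J := S) (homOfLE hxy)))

namespace IsComponents

theorem subset (h : IsComponents S K) (k : Fin n) : K k ⊆ S :=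
  fun x hx => (h.mem_iff x).2 ⟨k, hx⟩

theorem mem_iff_of_le (h : IsComponents S K) {k : Fin n} {x y : P} (hx : x ∈ S) (hy : y ∈ S)
    (hxy : x ≤ y) : x ∈ K k ↔ y ∈ K k := by
  obtain ⟨l, hl⟩ := (h.mem_iff x).1 hx
  obtain ⟨m, hm⟩ := (h.mem_iff y).1 hy
  obtain rfl := h.eq_of_le hl hm hxy
  exact ⟨fun hk => h.eq_of_le hk hm hxy ▸ hm, fun hk => h.eq_of_le hl hk hxy ▸ hl⟩

theorem isUpperSet (h : IsComponents S K) (hS : IsUpperSet S) (k : Fin n) : IsUpperSet (K k) :=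
  fun _ _ hxy hx =>
    (h.mem_iff_of_le (h.subset k hx) (hS hxy (h.subset k hx)) hxy).1 hx

theorem nonempty_orderIso (h : IsComponents S K) : Nonempty (S ≃o Σ k, K k) := by
  let g (x : Σ k, K k) : S := ⟨x.2, h.subset x.1 x.2.2⟩
  have hg (x y) : g x ≤ g y ↔ x ≤ y := by
    constructor
    · obtain ⟨k, x⟩ := x
      obtain ⟨l, y⟩ := y
      intro hxy
      obtain rfl := h.eq_of_le x.2 y.2 hxy
      exact Sigma.mk_le_mk_iff.2 hxy
    · rintro ⟨k, x, y, hxy⟩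
      exact hxy
  have hgsurj : Function.Surjective g := fun ⟨x, hx⟩ =>
    have ⟨k, hk⟩ := (h.mem_iff x).1 hx
    ⟨⟨k, x, hk⟩, rfl⟩
  exact ⟨(RelIso.ofSurjective (OrderEmbedding.ofMapLEIff g hg) hgsurj).symm⟩

end IsComponents

/-- The elements of `K` above `b`. -/
def above (b : P) (K : Set P) : UpperSet K :=
  ⟨{x | b ≤ x.1}, fun _ _ hxy hx => le_trans hx hxy⟩

variable (hb : Minimal (· ∈ S) b)

include hb in
theorem isUpperSet_diff_minimal (hS : IsUpperSet S) : IsUpperSet (S \ {b}) :=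
  fun _ _ hxy hx => ⟨hS hxy hx.1, fun hy => hx.2 (hb.eq_of_le hx.1 (hxy.trans_eq hy))⟩

/-- The functor with value `c y` on the arrow from the minimal element `b` to `y > b`, and `1` on
all other arrows. -/
noncomputable def stepFunctor {G : Type w} [Group G] (hb : Minimal (· ∈ S) b) (c : S → G)
    (hc : ∀ {x y : S}, b < x.1 → x ≤ y → c x = c y) : S ⥤ SingleObj G :=
  open Classical in
  { obj _ := SingleObj.star G
    map {x y} _ := (if x.1 = b ∧ y.1 ≠ b then c y else 1 : G)
    map_id x := if_neg fun hx => hx.2 hx.1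
    map_comp {x y z} f g := by
      change (_ : G) = _ * _
      have hxy : x.1 ≤ y.1 := leOfHom f
      have hyz : y.1 ≤ z.1 := leOfHom g
      by_cases hx : x.1 = b
      · by_cases hy : y.1 = b
        · by_cases hz : z.1 = b <;> simp [hx, hy, hz]
        · have hby : b < y.1 := (hx ▸ hxy).lt_of_ne' hy
          simp [hx, hy, (hby.trans_le hyz).ne', hc hby hyz]
      · have hy : y.1 ≠ b := fun hy => hx (hb.eq_of_le x.2 (hxy.trans_eq hy))
        simp [hx, hy] }

namespace IsComponents

variable (h : IsComponents (S \ {b}) K)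

include hb h in
theorem nonempty_above [CategoryTheory.IsConnected S] (k : Fin n) :
    Nonempty (above b (K k) : Set (K k)) := by
  by_contra hne
  have hle (x : P) (hx : x ∈ K k) : ¬ b ≤ x := fun hbx => hne ⟨⟨x, hx⟩, hbx⟩
  have ⟨x₀, hx₀⟩ := (h.isConnected k).is_nonempty
  have hbk : b ∉ K k := fun hbk => hle b hbk le_rfl
  have closed {x y : S} (f : x ⟶ y) : x.1 ∈ K k ↔ y.1 ∈ K k := by
    have hxy : x.1 ≤ y.1 := leOfHom f
    rcases eq_or_ne x.1 b with hx | hx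
    · exact iff_of_false (hx ▸ hbk) fun hy => hle y hy (hx ▸ hxy)
    · exact h.mem_iff_of_le ⟨x.2, hx⟩ ⟨y.2, fun hy => hx (hb.eq_of_le x.2 (hxy.trans_eq hy))⟩ hxy
  exact hbk (induct_on_objects (J := S) {x | x.1 ∈ K k}
    (j₀ := ⟨x₀, (h.subset k hx₀).1⟩) hx₀ closed ⟨b, hb.prop⟩)

include hb h in
theorem isPreconnected_above (hS : IsSimplyConnectedCategory S) (k : Fin n) :
    IsPreconnected (above b (K k) : Set (K k)) := by
  classical
  have := h.isConnected k
  refine IsPreconnected.of_constant_of_preserves_morphisms fun {α} φ hφ v w => ?_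
  let c (x : S) : FreeGroup α :=
    if hx : ∃ _ : x.1 ∈ K k, b ≤ x.1 then .of (φ ⟨⟨x, hx.1⟩, hx.2⟩) else 1
  have hc {x y : S} (hbx : b < x.1) (hxy : x ≤ y) : c x = c y := by
    have hbz (z : S) (hbz : b < z.1) : z.1 ∈ S \ {b} := ⟨z.2, hbz.ne'⟩
    have hk : x.1 ∈ K k ↔ y.1 ∈ K k :=
      h.mem_iff_of_le (hbz x hbx) (hbz y (hbx.trans_le hxy)) hxy
    by_cases hx : x.1 ∈ K k
    · have hy := hk.1 hx
      simp only [c, hx, hy, hbx.le, hbx.le.trans hxy, exists_const, dite_true]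
      exact congrArg _ (hφ (j₁ := ⟨⟨x, hx⟩, hbx.le⟩) (j₂ := ⟨⟨y, hy⟩, _⟩) (homOfLE hxy))
    · simp [c, hx, hk.not.1 hx]
  obtain ⟨ψ, hψ⟩ : ∃ ψ : S → FreeGroup α, ∀ {x y : S}, x ≤ y →
      ψ y = (if x.1 = b ∧ y.1 ≠ b then c y else 1) * ψ x :=
    have ⟨ψ, hψ⟩ := hS.exists_potential (stepFunctor hb c hc)
    ⟨ψ, fun hxy => hψ (homOfLE hxy)⟩
  have ψ_eq_of_mem (x y : K k) : ψ ⟨x, (h.subset k x.2).1⟩ = ψ ⟨y, (h.subset k y.2).1⟩ := by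
    refine constant_of_preserves_morphisms (fun z : K k => ψ ⟨z, (h.subset k z.2).1⟩)
      (fun z t f => ?_) x y
    have hzt : (⟨z, (h.subset k z.2).1⟩ : S) ≤ ⟨t, (h.subset k t.2).1⟩ := leOfHom f
    rw [hψ hzt, if_neg fun hz => (h.subset k z.2).2 hz.1, one_mul]
  have ψ_above (x : (above b (K k) : Set (K k))) :
      ψ ⟨x.1, (h.subset k x.1.2).1⟩ = .of (φ x) * ψ ⟨b, hb.prop⟩ := by
    have hmap : c ⟨x.1, (h.subset k x.1.2).1⟩ = .of (φ x) := dif_pos ⟨x.1.2, x.2⟩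
    have hbx : (⟨b, hb.prop⟩ : S) ≤ ⟨x.1, (h.subset k x.1.2).1⟩ := x.2
    rw [← hmap, hψ hbx, if_pos ⟨rfl, (h.subset k x.1.2).2⟩]
  exact FreeGroup.of_injective <| mul_right_cancel <|
    (ψ_above v).symm.trans <| (ψ_eq_of_mem v.1 w.1).trans (ψ_above w)

include hb h in
theorem nonempty_adjoinPoint_orderIso :
    Nonempty (S ≃o AdjoinPoint (fun k => K k) fun k => above b (K k)) := by
  let g : AdjoinPoint (fun k => K k) (fun k => above b (K k)) → S
    | .bot => ⟨b, hb.prop⟩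
    | .incl k x => ⟨x.1, (h.subset k x.2).1⟩
  have hg (x y) : g x ≤ g y ↔ x ≤ y := by
    constructor
    · intro hxy
      match x, y, hxy with
      | .bot, .bot, _ => exact .bot_bot
      | .bot, .incl k y, hxy => exact .bot_incl (U := fun k => above b (K k)) k y hxy
      | .incl k x, .bot, hxy =>
        exact absurd (hb.eq_of_le (h.subset k x.2).1 hxy) (h.subset k x.2).2
      | .incl k x, .incl l y, hxy =>
        obtain rfl := h.eq_of_le x.2 y.2 hxy
        exact .incl_incl (U := fun k => above b (K k)) k x y hxy
    · rintro (_ | ⟨k, x, hx⟩ | ⟨k, x, y, hxy⟩)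
      exacts [le_rfl, hx, hxy]
  have hgsurj : Function.Surjective g := by
    rintro ⟨x, hx⟩
    by_cases hxb : x = b
    · exact ⟨.bot, Subtype.ext hxb.symm⟩
    · obtain ⟨k, hk⟩ := (h.mem_iff x).1 ⟨hx, hxb⟩
      exact ⟨.incl k ⟨x, hk⟩, rfl⟩
  exact ⟨(RelIso.ofSurjective (OrderEmbedding.ofMapLEIff g hg) hgsurj).symm⟩

end IsComponents

theorem IsTreeLike.of_orderIso {Q : Type u} [PartialOrder Q] (e : P ≃o Q) (h : IsTreeLike Q) :
    IsTreeLike P := by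
  cases h with
  | mk K U hK hU e' => exact .mk K U hK hU (e.trans e')

variable [Finite P] (hP : ∀ U : Set P, IsUpperSet U → IsSimplyConnectedCategory U)

include hP in
theorem isTreeLike_of_isUpperSet {S : Set P} (hS : IsUpperSet S)
    (hconn : CategoryTheory.IsConnected S) : IsTreeLike S := by
  induction S using WellFoundedLT.induction with
  | ind S ih =>
  obtain ⟨b, hb⟩ := S.toFinite.exists_minimal (Set.nonempty_coe_sort.1 hconn.is_nonempty)
  obtain ⟨n, K, h⟩ := exists_isComponents (S \ {b})
  obtain ⟨e⟩ := h.nonempty_adjoinPoint_orderIso hb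
  have hKS (k) : K k < S :=
    ⟨fun x hx => (h.subset k hx).1, fun hSK => (h.subset k (hSK hb.prop)).2 rfl⟩
  refine .mk _ _ (fun k => ?_) (fun k => ?_) e
  · exact ih (K k) (hKS k) (h.isUpperSet (isUpperSet_diff_minimal hb hS) k) (h.isConnected k)
  · have := h.nonempty_above hb k
    exact { toIsPreconnected := h.isPreconnected_above hb (hP S hS) k }

include hP in
theorem isTreeLike_of_isConnected [CategoryTheory.IsConnected P] : IsTreeLike P :=
  have : CategoryTheory.IsConnected (Set.univ : Set P) :=
    isConnected_of_equivalent (OrderIso.Set.univ (α := P)).symm.equivalence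
  .of_orderIso OrderIso.Set.univ.symm (isTreeLike_of_isUpperSet hP isUpperSet_univ this)

include hP in
theorem isForestLike_of_isSimplyConnectedCategory : IsForestLike P :=
  have ⟨n, K, h⟩ := exists_isComponents (Set.univ : Set P)
  have ⟨e⟩ := h.nonempty_orderIso
  ⟨n, fun k => K k, fun _ => inferInstance,
    fun k => isTreeLike_of_isUpperSet hP (h.isUpperSet isUpperSet_univ k) (h.isConnected k),
    ⟨OrderIso.Set.univ.symm.trans e⟩⟩

end Decomposition

/-! ### Diagrams indexed by tree-like and forest-like posets -/

section TreeCocones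

variable {C : Type u₁} [Category.{v₁} C]

instance final_of_full_of_essSurj {J : Type*} [Category* J] {D : Type*} [Category* D] (K : J ⥤ D)
    [K.Full] [K.EssSurj] : K.Final where
  out d := by
    let i : StructuredArrow d K := .mk (K.objObjPreimageIso d).inv
    have hom (j : StructuredArrow d K) : Nonempty (i ⟶ j) :=
      ⟨StructuredArrow.homMk (K.preimage ((K.objObjPreimageIso d).hom ≫ j.hom)) (by simp [i])⟩
    exact .of_induct (j₀ := i) fun p hi hp j => (hp (hom j).some).1 hi

theorem EveryDiagramHasCocone.of_final {J : Type*} [Category* J] {D : Type*} [Category* D]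
    (K : J ⥤ D) [K.Final] (h : EveryDiagramHasCocone J C) : EveryDiagramHasCocone D C :=
  fun F => (h (K ⋙ F)).map Functor.Final.extendCocone.obj

theorem everyDiagramHasCocone_sigma (hC : JointEmbeddingProperty C) {n : ℕ} {K : Fin n → Type u}
    [∀ k, Category.{v} (K k)] (hK : ∀ k, EveryDiagramHasCocone (K k) C) :
    EveryDiagramHasCocone (Σ k, K k) C := by
  intro F
  let s (k : Fin n) : Cocone (Sigma.incl k ⋙ F) := (hK k _).some
  obtain ⟨A, h⟩ := jointEmbeddingProperty_iff.1 hC n fun k => (s k).pt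
  refine ⟨⟨A, ⟨fun ⟨k, x⟩ => (s k).ι.app x ≫ (h k).some, ?_⟩⟩⟩
  rintro _ _ (@⟨k, x, y, f⟩)
  exact (Category.assoc _ _ _).symm.trans
    ((congrArg (· ≫ (h k).some) ((s k).w f)).trans (Category.comp_id _).symm)

namespace AdjoinPoint

variable {n : ℕ} {K : Fin n → Type u} [∀ k, PartialOrder (K k)] {U : ∀ k, UpperSet (K k)}

theorem incl_mono (k : Fin n) : Monotone (incl (U := U) k) := fun _ _ hxy => .incl_incl k _ _ hxy

theorem bot_le_incl {k : Fin n} {x : K k} (hx : x ∈ U k) : (bot : AdjoinPoint K U) ≤ incl k x :=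
  .bot_incl k x hx

theorem comp_ι_eq (F : AdjoinPoint K U ⥤ C) {k : Fin n} (s : Cocone ((incl_mono k).functor ⋙ F))
    (hU : IsPreconnected (U k : Set (K k))) {x y : K k} (hx : x ∈ U k) (hy : y ∈ U k) :
    F.map (homOfLE (bot_le_incl hx)) ≫ s.ι.app x =
      F.map (homOfLE (bot_le_incl hy)) ≫ s.ι.app y := by
  refine constant_of_preserves_morphisms (J := (U k : Set (K k)))
    (fun z => F.map (homOfLE (bot_le_incl z.2)) ≫ s.ι.app z.1) (fun z t f => ?_) ⟨x, hx⟩ ⟨y, hy⟩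
  calc
    _ = F.map _ ≫ F.map ((incl_mono k).functor.map (homOfLE (leOfHom f))) ≫ s.ι.app t.1 :=
      congrArg (F.map _ ≫ ·) (s.w (homOfLE (leOfHom f))).symm
    _ = F.map _ ≫ s.ι.app t.1 :=
      (Category.assoc _ _ _).symm.trans (congrArg (· ≫ s.ι.app t.1) (F.map_comp _ _).symm)

theorem everyDiagramHasCocone (hC : AmalgamationProperty C)
    (hU : ∀ k, CategoryTheory.IsConnected (U k : Set (K k)))
    (hK : ∀ k, EveryDiagramHasCocone (K k) C) : EveryDiagramHasCocone (AdjoinPoint K U) C := by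
  intro F
  let s (k : Fin n) : Cocone ((incl_mono k).functor ⋙ F) := (hK k _).some
  let x₀ (k : Fin n) : (U k : Set (K k)) := (hU k).is_nonempty.some
  obtain ⟨A, g, h, hg⟩ := hC.exists_wide (fun k => (s k).pt) fun k =>
    F.map (homOfLE (bot_le_incl (x₀ k).2)) ≫ (s k).ι.app (x₀ k).1
  let c : ∀ a, F.obj a ⟶ A
    | .bot => g
    | .incl k x => (s k).ι.app x ≫ h k
  have hc {a b : AdjoinPoint K U} (hab : Le U a b) :
      F.map (homOfLE (show a ≤ b from hab)) ≫ c b = c a := by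
    cases hab with
    | bot_bot => exact (congrArg (· ≫ g) (F.map_id _)).trans (Category.id_comp _)
    | bot_incl k x hx =>
      calc
        _ = (F.map (homOfLE (bot_le_incl hx)) ≫ (s k).ι.app x) ≫ h k :=
          (Category.assoc _ _ _).symm
        _ = g := by rw [comp_ι_eq F (s k) (hU k).toIsPreconnected hx (x₀ k).2, hg k]
    | incl_incl k x y hxy =>
      exact (Category.assoc _ _ _).symm.trans (congrArg (· ≫ h k) ((s k).w (homOfLE hxy)))
  exact ⟨⟨A, ⟨c, fun _ _ f => (hc (leOfHom f)).trans (Category.comp_id _).symm⟩⟩⟩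

end AdjoinPoint

variable {P : Type u} [PartialOrder P]

theorem IsTreeLike.everyDiagramHasCocone (hC : AmalgamationProperty C) (h : IsTreeLike P) :
    EveryDiagramHasCocone P C := by
  induction h with
  | mk K U _ hU e ih =>
    exact (AdjoinPoint.everyDiagramHasCocone hC hU ih).of_final e.symm.equivalence.functor

theorem IsForestLike.everyDiagramHasCocone (hC : AmalgamationProperty C)
    (hC' : JointEmbeddingProperty C) (h : IsForestLike P) : EveryDiagramHasCocone P C := by
  obtain ⟨n, K, _, hK, ⟨e⟩⟩ := h
  -- The order on `Σ k, K k` and its structure of a disjoint union of categories differ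
  -- definitionally.
  let E : (Σ k, K k) ⥤ P := Sigma.desc fun k => Monotone.functor (f := fun x => e.symm ⟨k, x⟩)
    fun _ _ hxy => e.symm.monotone (Sigma.mk_le_mk_iff.2 hxy)
  have : E.Full := ⟨by
    rintro ⟨k, x⟩ ⟨l, y⟩ f
    obtain ⟨_, _, _, hxy⟩ := e.symm.le_iff_le.1 (leOfHom f)
    exact ⟨.mk (homOfLE hxy), rfl⟩⟩
  have : E.EssSurj := ⟨fun p => ⟨e p, ⟨eqToIso (e.symm_apply_apply p)⟩⟩⟩
  exact (everyDiagramHasCocone_sigma hC' fun k => (hK k).everyDiagramHasCocone hC).of_final E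

end TreeCocones

/-! ### Reduction to posets and monic morphisms -/

section Monic

variable {C : Type u₁} [Category.{v₁} C]

variable (C) in
/-- Two parallel morphisms are coequalizable if some further morphism identifies them. In a category
with the AP, this is the least congruence whose quotient has only monic morphisms. -/
def Coequalizable : HomRel C := fun _ Y f g => ∃ (Z : C) (h : Y ⟶ Z), f ≫ h = g ≫ h

theorem AmalgamationProperty.congruence_coequalizable (hC : AmalgamationProperty C) :
    Congruence (Coequalizable C) where
  comp_left f g g' := by
    rintro ⟨Z, h, hh⟩
    exact ⟨Z, h, by simp [hh]⟩
  comp_right {X Y Z f f'} g := by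
    rintro ⟨W, h, hh⟩
    obtain ⟨A, i, j, hij⟩ := amalgamationProperty_iff.1 hC g h
    exact ⟨A, i, by simp only [Category.assoc, hij, reassoc_of% hh]⟩
  equivalence :=
    { refl := fun f => ⟨_, 𝟙 _, rfl⟩
      symm := fun ⟨Z, h, hh⟩ => ⟨Z, h, hh.symm⟩
      trans := by
        rintro f f' f'' ⟨Z, h, hh⟩ ⟨Z', h', hh'⟩
        obtain ⟨A, i, j, hij⟩ := amalgamationProperty_iff.1 hC h h'
        exact ⟨A, h ≫ i, by rw [reassoc_of% hh, hij, reassoc_of% hh']⟩ }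

variable (C) in
/-- The quotient of a category with the AP in which all morphisms become monic. -/
abbrev MonicQuotient := CategoryTheory.Quotient (Coequalizable C)

namespace MonicQuotient

variable (C) in
/-- The projection to the quotient in which all morphisms become monic. -/
abbrev proj : C ⥤ MonicQuotient C := Quotient.functor _

theorem proj_map_eq_iff (hC : AmalgamationProperty C) {X Y : C} (f g : X ⟶ Y) :
    (proj C).map f = (proj C).map g ↔ Coequalizable C f g :=
  have := hC.congruence_coequalizable
  Quotient.functor_map_eq_iff _ f g

theorem mono (hC : AmalgamationProperty C) {X Y : MonicQuotient C} (f : X ⟶ Y) : Mono f := by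
  refine ⟨fun {Z} g h hgh => ?_⟩
  obtain ⟨f, rfl⟩ := (proj C).map_surjective (X := X.as) (Y := Y.as) f
  obtain ⟨g, rfl⟩ := (proj C).map_surjective (X := Z.as) (Y := X.as) g
  obtain ⟨h, rfl⟩ := (proj C).map_surjective (X := Z.as) (Y := X.as) h
  have hgh : (proj C).map (g ≫ f) = (proj C).map (h ≫ f) := by
    simpa only [Functor.map_comp] using hgh
  obtain ⟨W, k, hk⟩ := (proj_map_eq_iff hC _ _).1 hgh
  exact (proj_map_eq_iff hC _ _).2 ⟨W, f ≫ k, by simpa using hk⟩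

theorem amalgamationProperty (hC : AmalgamationProperty C) :
    AmalgamationProperty (MonicQuotient C) := by
  refine amalgamationProperty_iff.2 fun {X Y Z} f g => ?_
  obtain ⟨f, rfl⟩ := (proj C).map_surjective (X := X.as) (Y := Y.as) f
  obtain ⟨g, rfl⟩ := (proj C).map_surjective (X := X.as) (Y := Z.as) g
  obtain ⟨A, h, k, hk⟩ := amalgamationProperty_iff.1 hC f g
  refine ⟨(proj C).obj A, (proj C).map h, (proj C).map k, ?_⟩
  exact ((proj C).map_comp f h).symm.trans ((congrArg _ hk).trans ((proj C).map_comp g k))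

theorem jointEmbeddingProperty (hC : JointEmbeddingProperty C) :
    JointEmbeddingProperty (MonicQuotient C) := by
  refine jointEmbeddingProperty_iff.2 fun n X => ?_
  obtain ⟨A, h⟩ := jointEmbeddingProperty_iff.1 hC n fun k => (X k).as
  exact ⟨(proj C).obj A, fun k => ⟨(proj C).map (h k).some⟩⟩

variable {I : Type u} [Category.{v} I]

-- Each of the finitely many generating arrows needs a further morphism to make its triangle
-- commute in `C`; amalgamate these morphisms.
theorem nonempty_cocone (hC : AmalgamationProperty C) (hI : IsFinitelyGenerated I) (F : I ⥤ C)
    (h : Nonempty (Cocone (F ⋙ proj C))) : Nonempty (Cocone F) := by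
  obtain ⟨s⟩ := h
  choose c hc using fun X => (proj C).map_surjective (X := F.obj X) (Y := s.pt.as) (s.ι.app X)
  obtain ⟨W, hW, hgen⟩ := hI
  have hcoeq (f : Arrow I) : Coequalizable C (F.map f.hom ≫ c f.right) (c f.left) := by
    rw [← proj_map_eq_iff hC, Functor.map_comp, hc, hc]
    exact s.w f.hom
  choose A g hg using hcoeq
  have : Finite W.toSet := hW
  obtain ⟨n, ⟨e⟩⟩ := Finite.exists_equiv_fin W.toSet
  obtain ⟨B, i, j, hij⟩ := hC.exists_wide (fun k => A (e.symm k).1) fun k => g (e.symm k).1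
  let commuting : MorphismProperty I := fun X Y f => F.map f ≫ c Y ≫ i = c X ≫ i
  have hcommuting : commuting = ⊤ := by
    refine hgen _ ⟨fun f f' hf hf' => ?_⟩ fun X Y f hf => ?_
    · change F.map (f ≫ f') ≫ c _ ≫ i = c _ ≫ i
      rw [F.map_comp, Category.assoc, hf', hf]
    · obtain ⟨k, hk⟩ := e.symm.surjective ⟨Arrow.mk f, hf⟩
      have := hg (e.symm k).1 =≫ j k
      simp only [Category.assoc, hij] at this
      rwa [hk] at this
  exact ⟨⟨B, ⟨fun X => c X ≫ i, fun X Y f =>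
    (MorphismProperty.of_eq_top hcommuting f).trans (Category.comp_id _).symm⟩⟩⟩

end MonicQuotient

theorem map_eq_map_of_inj {I : Type u} [Category.{v} I] (h : EveryDiagramHasCocone I Inj.{v₁})
    (F : I ⥤ C) [∀ {X Y : I} (f : X ⟶ Y), Mono (F.map f)] {X Y : I} (f g : X ⟶ Y) :
    F.map f = F.map g := by
  obtain ⟨s⟩ := h (homDiagram F (F.obj X))
  have hs : s.ι.app Y (𝟙 (F.obj X) ≫ F.map f) = s.ι.app Y (𝟙 (F.obj X) ≫ F.map g) :=
    (s.w_apply f (𝟙 (F.obj X))).trans (s.w_apply g (𝟙 (F.obj X))).symm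
  exact (cancel_epi (𝟙 (F.obj X))).1 (Inj.injective_hom (s.ι.app Y) hs)

end Monic

section Reflection

variable (I : Type u) [Category.{v} I]

/-- The relation identifying all parallel morphisms. -/
def Parallel : HomRel I := fun _ _ _ _ => True

/-- The quotient of a category in which all parallel morphisms become equal. -/
abbrev ThinQuotient := CategoryTheory.Quotient (Parallel I)

instance : Quiver.IsThin (ThinQuotient I) := fun X Y => ⟨fun f g => by
  obtain ⟨f, rfl⟩ := (Quotient.functor _).map_surjective (X := X.as) (Y := Y.as) f
  obtain ⟨g, rfl⟩ := (Quotient.functor _).map_surjective (X := X.as) (Y := Y.as) g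
  exact CategoryTheory.Quotient.sound _ trivial⟩

/-- The poset reflection: the objects of a category preordered by the existence of morphisms, up to
antisymmetry. -/
abbrev PosetReflection : Type u := ThinSkeleton (ThinQuotient I)

namespace PosetReflection

/-- The projection to the poset reflection. -/
def proj : I ⥤ PosetReflection I := Quotient.functor _ ⋙ toThinSkeleton _

instance : (proj I).Full :=
  have : (toThinSkeleton (ThinQuotient I)).Full := ⟨fun f => ⟨(leOfHom f).some, rfl⟩⟩
  inferInstanceAs (Quotient.functor _ ⋙ toThinSkeleton (ThinQuotient I)).Full

theorem proj_obj_surjective : Function.Surjective (proj I).obj :=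
  Quotient.mk_surjective.comp fun X => ⟨X.as, rfl⟩

instance : (proj I).EssSurj :=
  ⟨fun p => let ⟨X, hX⟩ := proj_obj_surjective I p; ⟨X, ⟨eqToIso hX⟩⟩⟩

instance [Finite I] : Finite (PosetReflection I) := .of_surjective _ (proj_obj_surjective I)

instance [CategoryTheory.IsConnected I] : CategoryTheory.IsConnected (PosetReflection I) :=
  (Functor.isConnected_iff_of_final (proj I)).1 inferInstance

variable {I}

theorem nonempty_cocone {C : Type u₁} [Category.{v₁} C] (F : I ⥤ C)
    (hF : ∀ {X Y : I} (f g : X ⟶ Y), F.map f = F.map g)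
    (h : EveryDiagramHasCocone (PosetReflection I) C) : Nonempty (Cocone F) := by
  obtain ⟨s⟩ := h.of_final (ThinSkeleton.fromThinSkeleton (ThinQuotient I))
    (CategoryTheory.Quotient.lift _ F fun _ _ f g _ => hF f g)
  exact ⟨(Cocone.precompose (Quotient.lift.isLift _ F _).inv).obj (s.whisker (Quotient.functor _))⟩

end PosetReflection

end Reflection

/-! ### The main equivalences -/

section Main

variable {I : Type u} [Category.{v} I] {C : Type u₁} [Category.{v₁} C]

theorem IsUpwardSimplyConnected.isSimplyConnectedCategory_posetReflection [Finite I]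
    (h : IsUpwardSimplyConnected I) (U : Set (PosetReflection I)) (hU : IsUpperSet U) :
    IsSimplyConnectedCategory U :=
  isSimplyConnectedCategory_of_inj.{u, 0}
    ((everyDiagramHasCocone_inj.{u, v, 0} h).of_final (PosetReflection.proj I)) hU

theorem IsUpwardSimplyConnected.everyDiagramHasCocone_of_posetReflection
    (h : IsUpwardSimplyConnected I) (hI : IsFinitelyGenerated I) (hC : AmalgamationProperty C)
    (hP : EveryDiagramHasCocone (PosetReflection I) (MonicQuotient C)) :
    EveryDiagramHasCocone I C := fun F =>
  have := hI.finite
  have hInj : EveryDiagramHasCocone I Inj.{v₁} := everyDiagramHasCocone_inj.{u, v, v₁} h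
  have {X Y : I} (f : X ⟶ Y) := MonicQuotient.mono hC ((F ⋙ MonicQuotient.proj C).map f)
  MonicQuotient.nonempty_cocone hC hI F
    (PosetReflection.nonempty_cocone _ (map_eq_map_of_inj hInj _) hP)

theorem IsUpwardSimplyConnected.everyDiagramHasCocone (h : IsUpwardSimplyConnected I)
    (hI : IsFinitelyGenerated I) (hC : AmalgamationProperty C) (hC' : JointEmbeddingProperty C) :
    EveryDiagramHasCocone I C :=
  have := hI.finite
  have hP : IsForestLike (PosetReflection I) :=
    isForestLike_of_isSimplyConnectedCategory h.isSimplyConnectedCategory_posetReflection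
  h.everyDiagramHasCocone_of_posetReflection hI hC
    (hP.everyDiagramHasCocone (MonicQuotient.amalgamationProperty hC)
      (MonicQuotient.jointEmbeddingProperty hC'))

theorem IsUpwardSimplyConnected.everyDiagramHasCocone_of_isConnected [CategoryTheory.IsConnected I]
    (h : IsUpwardSimplyConnected I) (hI : IsFinitelyGenerated I) (hC : AmalgamationProperty C) :
    EveryDiagramHasCocone I C :=
  have := hI.finite
  have hP : IsTreeLike (PosetReflection I) :=
    isTreeLike_of_isConnected h.isSimplyConnectedCategory_posetReflection
  h.everyDiagramHasCocone_of_posetReflection hI hC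
    (hP.everyDiagramHasCocone (MonicQuotient.amalgamationProperty hC))

theorem isConnected_of_everyDiagramHasCocone
    (h : ∀ (C : Type u₁) [Category.{v₁} C], AmalgamationProperty C → EveryDiagramHasCocone I C) :
    CategoryTheory.IsConnected I := by
  have hdiscrete (α : Type) : EveryDiagramHasCocone I (Discrete α) :=
    let e : Discrete α ≌ ULiftHom.{v₁} (ULift.{u₁} (Discrete α)) :=
      ULiftHomULiftCategory.equiv (Discrete α)
    have := isGroupoid_of_reflects_iso e.inverse
    (h _ (amalgamationProperty_of_isGroupoid _)).of_equivalence e.symm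
  have : Nonempty I := by
    by_contra hI
    have : IsEmpty I := not_nonempty_iff.1 hI
    obtain ⟨s⟩ := hdiscrete Empty (functorOfIsEmpty _ _)
    exact s.pt.as.elim
  classical
  refine IsConnected.of_induct (j₀ := Classical.arbitrary I) fun p hp hcl j => ?_
  let F : I ⥤ Discrete Bool :=
    { obj X := ⟨decide (X ∈ p)⟩
      map f := Discrete.eqToHom (decide_eq_decide.2 (hcl f)) }
  obtain ⟨s⟩ := hdiscrete Bool F
  have hs : decide (Classical.arbitrary I ∈ p) = decide (j ∈ p) :=
    (Discrete.eq_of_hom (s.ι.app _)).trans (Discrete.eq_of_hom (s.ι.app j)).symm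
  exact (decide_eq_decide.1 hs).1 hp

theorem IsFinitelyGenerated.tfae_of_jointEmbedding (hI : IsFinitelyGenerated I) :
    List.TFAE [
      ∀ (C : Type u₁) [Category.{v₁} C], AmalgamationProperty C → JointEmbeddingProperty C →
        EveryDiagramHasCocone I C,
      EveryDiagramHasCocone I Inj.{w},
      IsUpwardSimplyConnected I] := by
  have := hI.finite
  tfae_have 1 → 3 := fun h => .of_amalgamable hI h
  tfae_have 3 → 1 := fun h C _ hC hC' => h.everyDiagramHasCocone hI hC hC'
  tfae_have 2 → 3 := fun h => .of_inj hI h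
  tfae_have 3 → 2 := IsUpwardSimplyConnected.everyDiagramHasCocone_inj.{u, v, w}
  tfae_finish

theorem IsFinitelyGenerated.tfae_of_amalgamation (hI : IsFinitelyGenerated I) :
    List.TFAE [
      ∀ (C : Type u₁) [Category.{v₁} C], AmalgamationProperty C → EveryDiagramHasCocone I C,
      CategoryTheory.IsConnected I ∧ EveryDiagramHasCocone I Inj.{w},
      CategoryTheory.IsConnected I ∧ IsUpwardSimplyConnected I] := by
  tfae_have 1 → 3 := fun h =>
    ⟨isConnected_of_everyDiagramHasCocone h, .of_amalgamable hI fun C _ hC _ => h C hC⟩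
  tfae_have 3 → 1 := fun ⟨_, h⟩ C _ hC => h.everyDiagramHasCocone_of_isConnected hI hC
  tfae_have 2 ↔ 3 := and_congr_right' (hI.tfae_of_jointEmbedding.{u, v, u₁, v₁, w}.out 1 2)
  tfae_finish

theorem poset_tfae_of_jointEmbedding {P : Type u} [PartialOrder P] [Finite P] :
    List.TFAE [
      ∀ (C : Type u₁) [Category.{v₁} C], AmalgamationProperty C → JointEmbeddingProperty C →
        EveryDiagramHasCocone P C,
      EveryDiagramHasCocone P Inj.{w},
      IsUpwardSimplyConnected P,
      ∀ U : Set P, IsUpperSet U → IsSimplyConnectedCategory U,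
      IsForestLike P] := by
  have tfae := (isFinitelyGenerated_of_finite (I := P)).tfae_of_jointEmbedding.{u, u, u₁, v₁, w}
  tfae_have 1 ↔ 2 := tfae.out 0 1
  tfae_have 2 ↔ 3 := tfae.out 1 2
  tfae_have 2 → 4 := fun h _ hU => isSimplyConnectedCategory_of_inj h hU
  tfae_have 4 → 5 := isForestLike_of_isSimplyConnectedCategory
  tfae_have 5 → 1 := fun h C _ hC hC' => h.everyDiagramHasCocone hC hC'
  tfae_finish

theorem poset_tfae_of_amalgamation {P : Type u} [PartialOrder P] [Finite P] :
    List.TFAE [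
      ∀ (C : Type u₁) [Category.{v₁} C], AmalgamationProperty C → EveryDiagramHasCocone P C,
      CategoryTheory.IsConnected P ∧ EveryDiagramHasCocone P Inj.{w},
      CategoryTheory.IsConnected P ∧ IsUpwardSimplyConnected P,
      CategoryTheory.IsConnected P ∧ ∀ U : Set P, IsUpperSet U → IsSimplyConnectedCategory U,
      CategoryTheory.IsConnected P ∧ IsForestLike P] := by
  have poset := poset_tfae_of_jointEmbedding.{u, u₁, v₁, w} (P := P)
  have tfae := (isFinitelyGenerated_of_finite (I := P)).tfae_of_amalgamation.{u, u, u₁, v₁, w}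
  tfae_have 1 ↔ 2 := tfae.out 0 1
  tfae_have 2 ↔ 3 := tfae.out 1 2
  tfae_have 3 ↔ 4 := and_congr_right' (poset.out 2 3)
  tfae_have 4 ↔ 5 := and_congr_right' (poset.out 3 4)
  tfae_finish

end Main

end AmalgamableShapes

theorem theorem1p1 :
    (∀ (I : Type u) [Category.{v} I], IsFinitelyGenerated I →
      -- cocones in all categories with AP and JEP; cocones for sets and injections;
      -- upward-simple-connectedness
      List.TFAE [
        ∀ (C : Type u₁) [Category.{v₁} C], AmalgamationProperty C → JointEmbeddingProperty C →
          EveryDiagramHasCocone I C,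
        EveryDiagramHasCocone I Inj.{w},
        IsUpwardSimplyConnected I] ∧
      -- for finite `I`, it suffices to consider diagrams of finite sets and injections
      (Finite I → (∀ X Y : I, Finite (X ⟶ Y)) →
        ((∀ F : I ⥤ Inj.{w}, (∀ X, Finite (F.obj X).carrier) → Nonempty (Cocone F)) ↔
          EveryDiagramHasCocone I Inj.{w})) ∧
      -- the version with the AP alone
      List.TFAE [
        ∀ (C : Type u₁) [Category.{v₁} C], AmalgamationProperty C → EveryDiagramHasCocone I C,
        CategoryTheory.IsConnected I ∧ EveryDiagramHasCocone I Inj.{w},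
        CategoryTheory.IsConnected I ∧ IsUpwardSimplyConnected I]) ∧
    (∀ (P : Type u) [PartialOrder P] [Finite P],
      -- for finite posets, two further equivalent conditions
      List.TFAE [
        ∀ (C : Type u₁) [Category.{v₁} C], AmalgamationProperty C → JointEmbeddingProperty C →
          EveryDiagramHasCocone P C,
        EveryDiagramHasCocone P Inj.{w},
        IsUpwardSimplyConnected P,
        ∀ U : Set P, IsUpperSet U → IsSimplyConnectedCategory U,
        IsForestLike P] ∧
      -- the version with the AP alone
      List.TFAE [
        ∀ (C : Type u₁) [Category.{v₁} C], AmalgamationProperty C → EveryDiagramHasCocone P C,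
        CategoryTheory.IsConnected P ∧ EveryDiagramHasCocone P Inj.{w},
        CategoryTheory.IsConnected P ∧ IsUpwardSimplyConnected P,
        CategoryTheory.IsConnected P ∧ ∀ U : Set P, IsUpperSet U → IsSimplyConnectedCategory U,
        CategoryTheory.IsConnected P ∧ IsForestLike P]) := by
  refine ⟨fun I _ hI => ⟨hI.tfae_of_jointEmbedding, fun _ _ =>
    ⟨everyDiagramHasCocone_inj_of_finite, fun h F _ => h F⟩, hI.tfae_of_amalgamation⟩,
    fun P _ _ => ⟨poset_tfae_of_jointEmbedding, poset_tfae_of_amalgamation⟩⟩
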